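/- Let $\Omega\subset\mathbb R^2$ be a polygon: a compact set whose boundary is a simple closed polygonal curve of length $L$, with the sides at each vertex not collinear. Let $\gamma:[0,L]\to\partial\Omega$ be an arc-length parameterization keeping the interior of $\Omega$ on its left, extended $L$-periodically to $\mathbb R$; the starting point $\gamma(0)$ may be any boundary point. Let $D(p,r)$ be the closed disk of radius $r>0$ about $p$, and let $$g(s,r)=\operatorname{area}(\Omega\cap D(\gamma(s),r)).$$ For each $s$ let $T_\gamma(s)=\{\alpha\Gamma^-+\beta\Gamma^+ : \alpha,\beta\ge 0,\ \alpha+\beta>0\}$, where $\Gamma^-=\lim_{t\uparrow s}\gamma'(t)$ and $\Gamma^+=\lim_{t\downarrow s}\gamma'(t)$. Call $\partial\Omega$ tangent-cone graph-like (TCGL) for radius $r$ if for every $s\in[0,L)$, every $w\in T_\gamma(s)$ and all distinct $u,v\in\partial\Omega\cap D(\gamma(s),r)$ one has $\langle w,u-v\rangle\ne0$. **Theorem.** Fix $r>0$. For a polygon $\Omega$ whose boundary is TCGL for radius $r$, the values $g(s,r)$, $\partial_r g(s,r)$ and the one-sided derivatives $\partial_s^{\pm}g(s,r)$ for all $s\in[0,L)$,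 at this one $r$, determine $\Omega$ up to translation and rotation. That is, let $\Omega_1,\Omega_2$ be two such polygons, TCGL for the same $r$, with parameterizations $\gamma_1,\gamma_2$ of the same length $L$ for which these functions on $[0,L)$ coincide. Then $\Omega_1$ and $\Omega_2$ have the same number of vertices, at the same arc-length positions; corresponding side lengths and interior vertex angles are equal; and there is a composition $T$ of a rotation and a translation with $\gamma_2=T\circ\gamma_1$ and $\Omega_2=T(\Omega_1)$. -/

import Mathlib

open Set Filter Topology MeasureTheory

/- The Euclidean plane is `ℂ`: its norm, real inner product and volume are those of `ℝ²`,
multiplication by `Complex.I` is the rotation by `π / 2`, and the compositions of rotations and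
translations are the maps `z ↦ a * z + b` with `‖a‖ = 1`. -/

/-- A polygon: a compact plane set whose boundary is a simple closed polygonal curve, together with
an arc-length parameterization `γ` of the boundary that keeps the interior on the left
(counterclockwise traversal). The parameterization is extended to `ℝ` with the perimeter as period,
and its starting point `γ 0` may be any boundary point. The vertices, in the order in which `γ`
visits them, are `γ (t i)` for `i : ℤ` (with `n` vertices per turn), `t 0` being the first vertex
parameter that is not negative. -/
structure ParamPolygon where
  /-- the region -/
  carrier : Set ℂ
  /-- the perimeter -/
  L : ℝ
  /-- the boundary parameterization -/
  γ : ℝ → ℂ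
  /-- the number of vertices -/
  n : ℕ
  /-- the arc-length positions of the vertices -/
  t : ℤ → ℝ
  three_le : 3 ≤ n
  isCompact : IsCompact carrier
  periodic : Function.Periodic γ L
  injOn : InjOn γ (Ico 0 L)
  frontier_eq : frontier carrier = γ '' Ico 0 L
  t_strictMono : StrictMono t
  t_zero : 0 ≤ t 0
  t_neg_one : t (-1) < 0
  t_add : ∀ i, t (i + n) = t i + L
  /-- between consecutive vertices, `γ` runs along the segment that joins them ... -/
  side : ∀ i, ∀ s ∈ Icc (t i) (t (i + 1)),
    γ s = AffineMap.lineMap (γ (t i)) (γ (t (i + 1))) ((s - t i) / (t (i + 1) - t i))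
  /-- ... with unit speed. -/
  unit_speed : ∀ i, dist (γ (t i)) (γ (t (i + 1))) = t (i + 1) - t i
  /-- the vertices are genuine corners -/
  corner : ∀ i, ¬ Collinear ℝ {γ (t (i - 1)), γ (t i), γ (t (i + 1))}
  /-- the interior lies on the left -/
  interior_left : ∀ s u, HasDerivAt γ u s →
    ∀ᶠ ε : ℝ in 𝓝[>] 0, γ s + ε • (Complex.I * u) ∈ interior carrier

/-- The tangent cone of a curve at the parameter `s`: the combinations
`α Γ⁻ + β Γ⁺` with `α, β ≥ 0`, `α + β > 0`, of the one-sided limits of the derivative at `s`. -/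
def arcTangentCone (γ : ℝ → ℂ) (s : ℝ) : Set ℂ :=
  {w | ∃ Γm Γp : ℂ, Tendsto (deriv γ) (𝓝[<] s) (𝓝 Γm) ∧ Tendsto (deriv γ) (𝓝[>] s) (𝓝 Γp) ∧
    ∃ α β : ℝ, 0 ≤ α ∧ 0 ≤ β ∧ 0 < α + β ∧ w = α • Γm + β • Γp}

namespace ParamPolygon

/-- The boundary is tangent-cone graph-like for radius `r`: at each boundary point `γ s`, the part
of the boundary in the closed disk of radius `r` about `γ s` is a graph in every orientation from
the tangent cone at `s`. -/
def TangentConeGraphLike (P : ParamPolygon) (r : ℝ) : Prop :=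
  ∀ s ∈ Ico 0 P.L, ∀ w ∈ arcTangentCone P.γ s,
    ∀ u ∈ frontier P.carrier ∩ Metric.closedBall (P.γ s) r,
      ∀ v ∈ frontier P.carrier ∩ Metric.closedBall (P.γ s) r,
        u ≠ v → inner ℝ w (u - v) ≠ 0

/-- The integral area invariant: the area of the part of the polygon in the disk of radius `r`
about `γ s`. -/
noncomputable def g (P : ParamPolygon) (s r : ℝ) : ℝ :=
  (volume (P.carrier ∩ Metric.closedBall (P.γ s) r)).toReal

/-- The `i`-th vertex. -/
def vertex (P : ParamPolygon) (i : ℤ) : ℂ := P.γ (P.t i)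

/-- The length of the side from the `i`-th vertex to the next one. -/
noncomputable def sideLength (P : ParamPolygon) (i : ℤ) : ℝ :=
  dist (P.vertex i) (P.vertex (i + 1))

/-- The interior angle at the `i`-th vertex: `π` minus the signed (counterclockwise) angle by which
the boundary turns there. -/
noncomputable def interiorAngle (P : ParamPolygon) (i : ℤ) : ℝ :=
  Real.pi - Complex.arg ((P.vertex (i + 1) - P.vertex i) / (P.vertex i - P.vertex (i - 1)))

end ParamPolygon

/-!
Fix a boundary point `c = γ s` of a polygon that is tangent-cone graph-like for radius `r`, with
one-sided unit tangents `Γ⁻`, `Γ⁺`. The idea is that the derivatives of the area invariant at `s`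
determine the rotation taking `Γ⁻` to `Γ⁺`; these rotations and the arc-length positions where they
are not trivial determine the curve up to a rigid motion.

*Structure of the boundary in the disk.* If the distance to `c` had a local extremum, with value at
most `r`, at another boundary point `q`, some vector of the tangent cone at `q` would be orthogonal
to `q - c`, against the hypothesis at `q` (`TangentConeGraphLike.crosses`). Hence the boundary
leaves the disk once, at `γ p`, comes back once, at `γ m`, and the distance to `c` is monotone on both
branches (`TangentConeGraphLike.exists_crossing`). The hypothesis at `s` puts the two branches on
different sides of the normal at `c`. A connectedness argument in polar coordinates then shows that
the circle meets the polygon exactly in the counterclockwise arc from `γ p` to `γ m`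
(`TwoBranches.mem_iff`, `TangentConeGraphLike.exists_arc`).

*Derivatives.* The area of a compact set in a region `ρ ≤ R x α` given in polar coordinates about
`c` is differentiated in `x` under the integral over `α` (`hasDerivAt_area`); it suffices that almost
every point of the limiting circle is off the frontier. So `∂ᵣ g` is the length `r * φ` of the arc,
and `∂ₛ^± g = ⟪Γ^±, I * χ⟫` for its chord `χ = γ p - γ m` (`TangentConeGraphLike.exists_chord`).
Now `φ` gives `‖χ‖`, and `⟪Γ^±, χ⟫ > 0` by the graph condition, so the data give `Γ^± * conj χ` and
thereby `Γ⁺ / Γ⁻` (`dirR_mul_dirL_eq`).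

*Rigidity.* The vertices are the points with `Γ⁺ ≠ Γ⁻`, so both polygons have the same vertex
parameters, and the side directions differ by a constant rotation; this gives the rigid motion on
the boundary. The region is recovered from its boundary because two compact sets with the same frontier
that lie on the same side of it near all but countably many frontier points are equal
(`IsCompact.subset_of_frontier_eq`): no form of the Jordan curve theorem is needed.
-/

/-! ### One-sided directions of the boundary parameterization -/

namespace ParamPolygon

variable (P : ParamPolygon)

theorem t_lt_t_add_one (i : ℤ) : P.t i < P.t (i + 1) := P.t_strictMono (by lia)

theorem L_pos : 0 < P.L := by
  have h := P.t_add 0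
  have h3 := P.three_le
  have : P.t 0 < P.t (0 + P.n) := P.t_strictMono (by lia)
  linarith

theorem t_add_mul (i k : ℤ) : P.t (i + k * P.n) = P.t i + k * P.L := by
  induction k using Int.induction_on with
  | zero => simp
  | succ k ih =>
    rw [show i + ((k : ℤ) + 1) * P.n = (i + k * P.n) + P.n by ring, P.t_add, ih]
    push_cast; ring
  | pred k ih =>
    have h := P.t_add (i + (-(k : ℤ) - 1) * P.n)
    rw [show i + (-(k : ℤ) - 1) * P.n + P.n = i + -(k : ℤ) * P.n by ring, ih] at h
    push_cast at h ⊢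
    linarith

theorem exists_t_lt (s : ℝ) : ∃ i, P.t i < s := by
  obtain ⟨k, hk⟩ := exists_int_lt ((s - P.t 0) / P.L)
  refine ⟨0 + k * P.n, ?_⟩
  rw [lt_div_iff₀ P.L_pos] at hk
  rw [P.t_add_mul]; linarith

theorem exists_lt_t (s : ℝ) : ∃ i, s < P.t i := by
  obtain ⟨k, hk⟩ := exists_int_gt ((s - P.t 0) / P.L)
  refine ⟨0 + k * P.n, ?_⟩
  rw [div_lt_iff₀ P.L_pos] at hk
  rw [P.t_add_mul]; linarith

theorem exists_mem_Ico (s : ℝ) : ∃ i, s ∈ Ico (P.t i) (P.t (i + 1)) := by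
  obtain ⟨j, hj⟩ := P.exists_lt_t s
  obtain ⟨j', hj'⟩ := P.exists_t_lt s
  obtain ⟨i, hi, hi'⟩ := Int.exists_greatest_of_bdd (P := fun i => P.t i ≤ s)
    ⟨j, fun z hz => (P.t_strictMono.lt_iff_lt.1 (hz.trans_lt hj)).le⟩ ⟨j', hj'.le⟩
  refine ⟨i, hi, lt_of_not_ge fun h => ?_⟩
  have := hi' _ h
  lia

theorem exists_mem_Ioc (s : ℝ) : ∃ i, s ∈ Ioc (P.t i) (P.t (i + 1)) := by
  obtain ⟨j, hj⟩ := P.exists_lt_t s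
  obtain ⟨j', hj'⟩ := P.exists_t_lt s
  obtain ⟨i, hi, hi'⟩ := Int.exists_greatest_of_bdd (P := fun i => P.t i < s)
    ⟨j, fun z hz => (P.t_strictMono.lt_iff_lt.1 (hz.trans hj)).le⟩ ⟨j', hj'⟩
  refine ⟨i, hi, le_of_not_gt fun h => ?_⟩
  have := hi' _ h
  lia

/-- The unit direction of the `i`-th side. -/
noncomputable def dir (i : ℤ) : ℂ := (P.t (i + 1) - P.t i)⁻¹ • (P.vertex (i + 1) - P.vertex i)

theorem norm_dir (i : ℤ) : ‖P.dir i‖ = 1 := by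
  have h := P.t_lt_t_add_one i
  have h' : ‖P.vertex (i + 1) - P.vertex i‖ = P.t (i + 1) - P.t i := by
    rw [← P.unit_speed i, dist_comm, dist_eq_norm]; rfl
  rw [dir, norm_smul, h', Real.norm_of_nonneg (inv_nonneg.2 (sub_pos.2 h).le)]
  exact inv_mul_cancel₀ (sub_pos.2 h).ne'

theorem vertex_succ (i : ℤ) :
    P.vertex (i + 1) = P.vertex i + (P.t (i + 1) - P.t i) • P.dir i := by
  have h := sub_pos.2 (P.t_lt_t_add_one i)
  rw [dir, smul_smul, mul_inv_cancel₀ h.ne', one_smul]; ring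

theorem γ_eq {i : ℤ} {s : ℝ} (hs : s ∈ Icc (P.t i) (P.t (i + 1))) :
    P.γ s = P.vertex i + (s - P.t i) • P.dir i := by
  rw [P.side i s hs, AffineMap.lineMap_apply, dir, smul_smul, div_eq_mul_inv]
  simp only [vsub_eq_sub, vadd_eq_add, vertex]; ring

theorem γ_add {i : ℤ} {s u : ℝ} (hs : s ∈ Icc (P.t i) (P.t (i + 1)))
    (hu : u ∈ Icc (P.t i) (P.t (i + 1))) : P.γ u = P.γ s + (u - s) • P.dir i := by
  rw [P.γ_eq hs, P.γ_eq hu, add_assoc, ← add_smul]; congr 2; ring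

/-- The right-hand unit tangent `Γ⁺` of the boundary at the parameter `s`. -/
noncomputable def dirR (s : ℝ) : ℂ := P.dir (P.exists_mem_Ico s).choose

/-- The left-hand unit tangent `Γ⁻` of the boundary at the parameter `s`. -/
noncomputable def dirL (s : ℝ) : ℂ := P.dir (P.exists_mem_Ioc s).choose

theorem norm_dirR (s : ℝ) : ‖P.dirR s‖ = 1 := P.norm_dir _

theorem norm_dirL (s : ℝ) : ‖P.dirL s‖ = 1 := P.norm_dir _

theorem eq_of_mem_Ico {i j : ℤ} {s : ℝ} (hi : s ∈ Ico (P.t i) (P.t (i + 1)))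
    (hj : s ∈ Ico (P.t j) (P.t (j + 1))) : i = j := by
  have h1 := P.t_strictMono.lt_iff_lt.1 (hi.1.trans_lt hj.2)
  have h2 := P.t_strictMono.lt_iff_lt.1 (hj.1.trans_lt hi.2)
  lia

theorem eq_of_mem_Ioc {i j : ℤ} {s : ℝ} (hi : s ∈ Ioc (P.t i) (P.t (i + 1)))
    (hj : s ∈ Ioc (P.t j) (P.t (j + 1))) : i = j := by
  have h1 := P.t_strictMono.lt_iff_lt.1 (hi.1.trans_le hj.2)
  have h2 := P.t_strictMono.lt_iff_lt.1 (hj.1.trans_le hi.2)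
  lia

theorem dirR_eq {i : ℤ} {s : ℝ} (hs : s ∈ Ico (P.t i) (P.t (i + 1))) : P.dirR s = P.dir i := by
  rw [dirR, P.eq_of_mem_Ico (P.exists_mem_Ico s).choose_spec hs]

theorem dirL_eq {i : ℤ} {s : ℝ} (hs : s ∈ Ioc (P.t i) (P.t (i + 1))) : P.dirL s = P.dir i := by
  rw [dirL, P.eq_of_mem_Ioc (P.exists_mem_Ioc s).choose_spec hs]

theorem dirR_t (i : ℤ) : P.dirR (P.t i) = P.dir i := P.dirR_eq ⟨le_rfl, P.t_lt_t_add_one i⟩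

theorem dirL_t_succ (i : ℤ) : P.dirL (P.t (i + 1)) = P.dir i :=
  P.dirL_eq ⟨P.t_lt_t_add_one i, le_rfl⟩

theorem exists_γ_add_right (s : ℝ) :
    ∃ δ > 0, ∀ h ∈ Icc 0 δ, P.γ (s + h) = P.γ s + h • P.dirR s := by
  obtain ⟨i, hi⟩ := P.exists_mem_Ico s
  refine ⟨P.t (i + 1) - s, sub_pos.2 hi.2, fun h hh => ?_⟩
  rw [P.dirR_eq hi, P.γ_add (i := i) (s := s) (u := s + h) ⟨hi.1, hi.2.le⟩
    ⟨by linarith [hi.1, hh.1], by linarith [hh.2]⟩, add_sub_cancel_left]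

theorem exists_γ_sub_left (s : ℝ) :
    ∃ δ > 0, ∀ h ∈ Icc 0 δ, P.γ (s - h) = P.γ s - h • P.dirL s := by
  obtain ⟨i, hi⟩ := P.exists_mem_Ioc s
  refine ⟨s - P.t i, sub_pos.2 hi.1, fun h hh => ?_⟩
  rw [P.dirL_eq hi, P.γ_add (i := i) (s := s) (u := s - h) ⟨hi.1.le, hi.2⟩
    ⟨by linarith [hh.2], by linarith [hh.1, hi.2]⟩, sub_sub_cancel_left, neg_smul, sub_eq_add_neg]

theorem dirR_add_L (s : ℝ) : P.dirR (s + P.L) = P.dirR s := by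
  obtain ⟨δ, hδ, h⟩ := P.exists_γ_add_right s
  obtain ⟨δ', hδ', h'⟩ := P.exists_γ_add_right (s + P.L)
  have hm : min δ δ' ≠ 0 := (lt_min hδ hδ').ne'
  have e := h _ ⟨(lt_min hδ hδ').le, min_le_left _ _⟩
  have e' := h' _ ⟨(lt_min hδ hδ').le, min_le_right _ _⟩
  rw [add_right_comm, P.periodic, P.periodic, e] at e'
  exact (smul_right_injective ℂ hm (add_left_cancel e')).symm

theorem dirL_add_L (s : ℝ) : P.dirL (s + P.L) = P.dirL s := by
  obtain ⟨δ, hδ, h⟩ := P.exists_γ_sub_left s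
  obtain ⟨δ', hδ', h'⟩ := P.exists_γ_sub_left (s + P.L)
  have hm : min δ δ' ≠ 0 := (lt_min hδ hδ').ne'
  have e := h _ ⟨(lt_min hδ hδ').le, min_le_left _ _⟩
  have e' := h' _ ⟨(lt_min hδ hδ').le, min_le_right _ _⟩
  rw [add_sub_right_comm, P.periodic, P.periodic, e] at e'
  exact (smul_right_injective ℂ hm (sub_right_injective e')).symm

theorem continuous_γ : Continuous P.γ := by
  refine continuous_iff_continuousAt.2 fun s => continuousAt_iff_continuous_left_right.2 ⟨?_, ?_⟩
  · obtain ⟨δ, hδ, h⟩ := P.exists_γ_sub_left s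
    have hc : ContinuousWithinAt (fun u => P.γ s - (s - u) • P.dirL s) (Iic s) s := by
      apply Continuous.continuousWithinAt; fun_prop
    refine hc.congr_of_eventuallyEq ?_ (by simp)
    filter_upwards [Icc_mem_nhdsLE (sub_lt_self s hδ)] with u hu
    rw [← h (s - u) ⟨by linarith [hu.2], by linarith [hu.1]⟩, sub_sub_cancel]
  · obtain ⟨δ, hδ, h⟩ := P.exists_γ_add_right s
    have hc : ContinuousWithinAt (fun u => P.γ s + (u - s) • P.dirR s) (Ici s) s := by
      apply Continuous.continuousWithinAt; fun_prop
    refine hc.congr_of_eventuallyEq ?_ (by simp)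
    filter_upwards [Icc_mem_nhdsGE (lt_add_of_pos_right s hδ)] with u hu
    rw [← h (u - s) ⟨by linarith [hu.1], by linarith [hu.2]⟩, add_sub_cancel]

theorem hasDerivAt_γ {i : ℤ} {s : ℝ} (hs : s ∈ Ioo (P.t i) (P.t (i + 1))) :
    HasDerivAt P.γ (P.dir i) s := by
  have hd : HasDerivAt (fun u => P.γ s + (u - s) • P.dir i) ((1 : ℝ) • P.dir i) s :=
    (((hasDerivAt_id s).sub_const s).smul_const (P.dir i)).const_add _
  rw [one_smul] at hd
  refine hd.congr_of_eventuallyEq ?_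
  filter_upwards [Icc_mem_nhds hs.1 hs.2] with u hu
  exact P.γ_add (Ioo_subset_Icc_self hs) hu

theorem tendsto_deriv_right (s : ℝ) : Tendsto (deriv P.γ) (𝓝[>] s) (𝓝 (P.dirR s)) := by
  obtain ⟨i, hi⟩ := P.exists_mem_Ico s
  refine tendsto_const_nhds.congr' ?_
  filter_upwards [Ioo_mem_nhdsGT hi.2] with u hu
  rw [(P.hasDerivAt_γ ⟨hi.1.trans_lt hu.1, hu.2⟩).deriv, P.dirR_eq hi]

theorem tendsto_deriv_left (s : ℝ) : Tendsto (deriv P.γ) (𝓝[<] s) (𝓝 (P.dirL s)) := by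
  obtain ⟨i, hi⟩ := P.exists_mem_Ioc s
  refine tendsto_const_nhds.congr' ?_
  filter_upwards [Ioo_mem_nhdsLT hi.1] with u hu
  rw [(P.hasDerivAt_γ ⟨hu.1, hu.2.trans_le hi.2⟩).deriv, P.dirL_eq hi]

theorem exists_mem_Ico_add (s : ℝ) : ∃ s' ∈ Ico 0 P.L, ∃ k : ℤ, s = s' + k * P.L := by
  refine ⟨toIcoMod P.L_pos 0 s, by simpa using toIcoMod_mem_Ico P.L_pos 0 s,
    toIcoDiv P.L_pos 0 s, ?_⟩
  rw [← zsmul_eq_mul, toIcoMod_add_toIcoDiv_zsmul]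

theorem γ_add_mul (s : ℝ) (k : ℤ) : P.γ (s + k * P.L) = P.γ s := P.periodic.int_mul k s

theorem dirR_add_mul (s : ℝ) (k : ℤ) : P.dirR (s + k * P.L) = P.dirR s :=
  Function.Periodic.int_mul P.dirR_add_L k s

theorem dirL_add_mul (s : ℝ) (k : ℤ) : P.dirL (s + k * P.L) = P.dirL s :=
  Function.Periodic.int_mul P.dirL_add_L k s

theorem γ_mem_frontier (s : ℝ) : P.γ s ∈ frontier P.carrier := by
  obtain ⟨s', hs', k, rfl⟩ := P.exists_mem_Ico_add s
  rw [P.frontier_eq, P.γ_add_mul]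
  exact mem_image_of_mem _ hs'

theorem exists_γ_eq_of_mem_frontier (s : ℝ) {z : ℂ} (hz : z ∈ frontier P.carrier) :
    ∃ u ∈ Ico s (s + P.L), P.γ u = z := by
  rw [P.frontier_eq] at hz
  obtain ⟨u, -, rfl⟩ := hz
  obtain ⟨y, hy, h⟩ := P.periodic.exists_mem_Ico P.L_pos u s
  exact ⟨y, hy, h.symm⟩

theorem γ_ne {s u : ℝ} (h : s < u) (h' : u < s + P.L) : P.γ u ≠ P.γ s := by
  intro e
  obtain ⟨s', hs', k, rfl⟩ := P.exists_mem_Ico_add s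
  obtain ⟨u', hu', l, rfl⟩ := P.exists_mem_Ico_add u
  rw [P.γ_add_mul, P.γ_add_mul] at e
  obtain rfl := P.injOn hu' hs' e
  have hL := P.L_pos
  have h1 : (k : ℝ) < l := by nlinarith
  have h2 : (l : ℝ) < k + 1 := by nlinarith
  norm_cast at h1 h2
  lia

/-- The tangent-cone condition, at an arbitrary parameter and in terms of the one-sided unit
tangents. -/
theorem TangentConeGraphLike.inner_ne {P : ParamPolygon} {r : ℝ} (hP : P.TangentConeGraphLike r)
    (s : ℝ) {α β : ℝ} (hα : 0 ≤ α) (hβ : 0 ≤ β) (hαβ : 0 < α + β) {u v : ℝ}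
    (hu : ‖P.γ u - P.γ s‖ ≤ r) (hv : ‖P.γ v - P.γ s‖ ≤ r) (huv : P.γ u ≠ P.γ v) :
    inner ℝ (α • P.dirL s + β • P.dirR s) (P.γ u - P.γ v) ≠ 0 := by
  obtain ⟨s', hs', k, rfl⟩ := P.exists_mem_Ico_add s
  rw [P.γ_add_mul] at hu hv
  rw [P.dirL_add_mul, P.dirR_add_mul]
  exact hP s' hs' _ ⟨_, _, P.tendsto_deriv_left s', P.tendsto_deriv_right s',
    α, β, hα, hβ, hαβ, rfl⟩
    _ ⟨P.γ_mem_frontier u, by rwa [mem_closedBall_iff_norm]⟩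
    _ ⟨P.γ_mem_frontier v, by rwa [mem_closedBall_iff_norm]⟩ huv

end ParamPolygon

/-! ### Functions without extrema in a sublevel set -/

/-- `f` passes strictly upwards through its value at `t`. -/
def CrossesUp (f : ℝ → ℝ) (t : ℝ) : Prop :=
  (∀ᶠ u in 𝓝[<] t, f u < f t) ∧ ∀ᶠ u in 𝓝[>] t, f t < f u

/-- `f` passes strictly downwards through its value at `t`. -/
def CrossesDown (f : ℝ → ℝ) (t : ℝ) : Prop :=
  (∀ᶠ u in 𝓝[<] t, f t < f u) ∧ ∀ᶠ u in 𝓝[>] t, f u < f t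

theorem CrossesDown.comp_neg {f : ℝ → ℝ} {t : ℝ} (h : CrossesDown f t) :
    CrossesUp (fun u => f (-u)) (-t) := by
  have h1 : Tendsto (fun u : ℝ => -u) (𝓝[<] (-t)) (𝓝[>] t) := by
    simpa using tendsto_neg_nhdsLT (a := -t)
  have h2 : Tendsto (fun u : ℝ => -u) (𝓝[>] (-t)) (𝓝[<] t) := by
    simpa using tendsto_neg_nhdsGT (a := -t)
  exact ⟨by simpa using h1.eventually h.2, by simpa using h2.eventually h.1⟩

theorem CrossesUp.comp_neg {f : ℝ → ℝ} {t : ℝ} (h : CrossesUp f t) :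
    CrossesDown (fun u => f (-u)) (-t) := by
  have h1 : Tendsto (fun u : ℝ => -u) (𝓝[<] (-t)) (𝓝[>] t) := by
    simpa using tendsto_neg_nhdsLT (a := -t)
  have h2 : Tendsto (fun u : ℝ => -u) (𝓝[>] (-t)) (𝓝[<] t) := by
    simpa using tendsto_neg_nhdsGT (a := -t)
  exact ⟨by simpa using h1.eventually h.2, by simpa using h2.eventually h.1⟩

section Crossing

variable {f : ℝ → ℝ} {a b r : ℝ}

/-- To the left of an upward crossing at a level at most `r`, the minimum of `f` over an interval
`[t₁, t₀]` can only be attained at `t₁`. -/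
theorem CrossesUp.strictMonoOn (hf : Continuous f)
    (hd : ∀ t ∈ Ioo a b, f t ≤ r → CrossesUp f t ∨ CrossesDown f t) {t₀ : ℝ} (ht₀ : t₀ ∈ Ioo a b)
    (hr : f t₀ ≤ r) (h : CrossesUp f t₀) : StrictMonoOn f (Icc a t₀) := by
  intro x hx y hy hxy
  obtain ⟨m, hm, hmin⟩ := (isCompact_Icc (a := x) (b := t₀)).exists_isMinOn
    ⟨x, le_rfl, hx.2⟩ hf.continuousOn
  have hle : ∀ u ∈ Icc x t₀, f m ≤ f u := fun u hu => hmin hu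
  -- every minimizer over `[x, t₀]` is `x`
  have key : ∀ m ∈ Icc x t₀, (∀ u ∈ Icc x t₀, f m ≤ f u) → m = x := by
    intro m hm hle
    by_contra hne
    have hxm : x < m := lt_of_le_of_ne hm.1 (Ne.symm hne)
    have hleft : ∃ᶠ u in 𝓝[<] m, f m ≤ f u := by
      apply Eventually.frequently
      filter_upwards [Ioo_mem_nhdsLT hxm] with u hu
      exact hle u ⟨hu.1.le, hu.2.le.trans hm.2⟩
    rcases hm.2.eq_or_lt with rfl | hlt
    · obtain ⟨u, hu, hu'⟩ := (hleft.and_eventually h.1).exists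
      exact absurd hu' hu.not_gt
    · rcases hd m ⟨hx.1.trans_lt hxm, hlt.trans ht₀.2⟩
        ((hle t₀ ⟨hxm.le.trans hlt.le, le_rfl⟩).trans hr) with hu | hu
      · obtain ⟨u, hu, hu'⟩ := (hleft.and_eventually hu.1).exists
        exact absurd hu' hu.not_gt
      · obtain ⟨u, hu, hu'⟩ := (hu.2.and (Ioo_mem_nhdsGT hlt)).exists
        exact absurd hu (hle u ⟨hxm.le.trans hu'.1.le, hu'.2.le⟩).not_gt
  obtain rfl := key m hm hle
  refine lt_of_le_of_ne (hle y ⟨hxy.le, hy.2⟩) fun e => ?_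
  exact hxy.ne' (key y ⟨hxy.le, hy.2⟩ fun u hu => e ▸ hle u hu)

theorem CrossesDown.strictAntiOn (hf : Continuous f)
    (hd : ∀ t ∈ Ioo a b, f t ≤ r → CrossesUp f t ∨ CrossesDown f t) {t₀ : ℝ} (ht₀ : t₀ ∈ Ioo a b)
    (hr : f t₀ ≤ r) (h : CrossesDown f t₀) : StrictAntiOn f (Icc t₀ b) := by
  have := h.comp_neg.strictMonoOn (a := -b) (b := -a) (r := r) (by fun_prop) (fun t ht htr => by
      have := hd (-t) ⟨by linarith [ht.2], by linarith [ht.1]⟩ htr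
      rw [← neg_neg t]
      exact this.symm.imp CrossesDown.comp_neg CrossesUp.comp_neg)
    ⟨neg_lt_neg ht₀.2, neg_lt_neg ht₀.1⟩ (by simpa using hr)
  intro x hx y hy hxy
  simpa using this (a := -y) (b := -x) ⟨neg_le_neg hy.2, neg_le_neg hy.1⟩
    ⟨neg_le_neg hx.2, neg_le_neg hx.1⟩ (neg_lt_neg hxy)

/-- A continuous function that vanishes exactly at the endpoints of `[a, b]` and has no local
extremum below the level `r` rises to `r`, stays above `r`, and falls back to `0`. -/
theorem exists_rise_fall (hf : Continuous f)
    (hd : ∀ t ∈ Ioo a b, f t ≤ r → CrossesUp f t ∨ CrossesDown f t) (hab : a < b) (hr : 0 < r)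
    (ha : f a = 0) (hb : f b = 0) (hpos : ∀ t ∈ Ioo a b, 0 < f t) :
    ∃ p m, a < p ∧ p < m ∧ m < b ∧ f p = r ∧ f m = r ∧ StrictMonoOn f (Icc a p) ∧
      StrictAntiOn f (Icc m b) ∧ ∀ t ∈ Ioo a b, f t ≤ r → t ∈ Ioc a p ∨ t ∈ Ico m b := by
  obtain ⟨M, hM, hmax⟩ := (isCompact_Icc (a := a) (b := b)).exists_isMaxOn
    ⟨a, le_rfl, hab.le⟩ hf.continuousOn
  have hle : ∀ u ∈ Icc a b, f u ≤ f M := fun u hu => hmax hu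
  have hMpos : 0 < f M := (hpos ((a + b) / 2) ⟨by linarith, by linarith⟩).trans_le
    (hle _ ⟨by linarith, by linarith⟩)
  have haM : a < M := lt_of_le_of_ne hM.1 (by rintro rfl; linarith)
  have hMb : M < b := lt_of_le_of_ne hM.2 (by rintro rfl; linarith)
  have hMr : r < f M := by
    by_contra! hcon
    rcases hd M ⟨haM, hMb⟩ hcon with h | h
    · obtain ⟨u, hu, hu'⟩ := (h.2.and (Ioo_mem_nhdsGT hMb)).exists
      exact absurd hu (hle u ⟨haM.le.trans hu'.1.le, hu'.2.le⟩).not_gt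
    · obtain ⟨u, hu, hu'⟩ := (h.1.and (Ioo_mem_nhdsLT haM)).exists
      exact absurd hu (hle u ⟨hu'.1.le, hu'.2.le.trans hMb.le⟩).not_gt
  obtain ⟨p, ⟨⟨hp1, hp2⟩, hp3⟩, hpl⟩ := (isCompact_Icc.inter_right
    (isClosed_le continuous_const hf) : IsCompact (Icc a M ∩ {t | r ≤ f t})).exists_isLeast
    ⟨M, ⟨haM.le, le_rfl⟩, hMr.le⟩
  obtain ⟨m, ⟨⟨hm1, hm2⟩, hm3⟩, hml⟩ := (isCompact_Icc.inter_right
    (isClosed_le continuous_const hf) : IsCompact (Icc M b ∩ {t | r ≤ f t})).exists_isGreatest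
    ⟨M, ⟨le_rfl, hMb.le⟩, hMr.le⟩
  change r ≤ f p at hp3
  change r ≤ f m at hm3
  have hap : a < p := lt_of_le_of_ne hp1 (by rintro rfl; linarith)
  have hmb : m < b := lt_of_le_of_ne hm2 (by rintro rfl; linarith)
  have hpl' : ∀ᶠ u in 𝓝[<] p, f u < r := by
    filter_upwards [Ioo_mem_nhdsLT hap] with u hu
    by_contra! hcon
    exact (hpl ⟨⟨hu.1.le, hu.2.le.trans hp2⟩, hcon⟩).not_gt hu.2
  have hml' : ∀ᶠ u in 𝓝[>] m, f u < r := by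
    filter_upwards [Ioo_mem_nhdsGT hmb] with u hu
    by_contra! hcon
    exact (hml ⟨⟨hm1.trans hu.1.le, hu.2.le⟩, hcon⟩).not_gt hu.1
  have hpr : f p = r := le_antisymm
    (le_of_tendsto (hf.continuousWithinAt (s := Iio p)) (hpl'.mono fun _ h => h.le)) hp3
  have hmr : f m = r := le_antisymm
    (le_of_tendsto (hf.continuousWithinAt (s := Ioi m)) (hml'.mono fun _ h => h.le)) hm3
  have hpM : p < M := lt_of_le_of_ne hp2 (by rintro rfl; linarith)
  have hMm : M < m := lt_of_le_of_ne hm1 (by rintro rfl; linarith)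
  have hpI : p ∈ Ioo a b := ⟨hap, hpM.trans hMb⟩
  have hmI : m ∈ Ioo a b := ⟨haM.trans hMm, hmb⟩
  have hup : CrossesUp f p := (hd p hpI hpr.le).resolve_right fun h => by
    obtain ⟨u, hu, hu'⟩ := (h.1.and hpl').exists
    linarith
  have hdown : CrossesDown f m := (hd m hmI hmr.le).resolve_left fun h => by
    obtain ⟨u, hu, hu'⟩ := (h.2.and hml').exists
    linarith
  refine ⟨p, m, hap, hpM.trans hMm, hmb, hpr, hmr, hup.strictMonoOn hf hd hpI hpr.le,
    hdown.strictAntiOn hf hd hmI hmr.le, fun t ht htr => ?_⟩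
  rcases hd t ht htr with h | h
  · left
    refine ⟨ht.1, le_of_not_gt fun hlt => ?_⟩
    have := h.strictMonoOn hf hd ht htr ⟨hap.le, hlt.le⟩ ⟨ht.1.le, le_rfl⟩ hlt
    linarith
  · right
    refine ⟨le_of_not_gt fun hlt => ?_, ht.2⟩
    have := h.strictAntiOn hf hd ht htr ⟨le_rfl, ht.2.le⟩ ⟨hlt.le, hmb.le⟩ hlt
    linarith

end Crossing

/-! ### The boundary inside a disk centred on it -/

theorem norm_add_smul_sq (d v : ℂ) (h : ℝ) :
    ‖d + h • v‖ ^ 2 = ‖d‖ ^ 2 + 2 * h * inner ℝ v d + h ^ 2 * ‖v‖ ^ 2 := by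
  rw [norm_add_sq_real, real_inner_smul_right, norm_smul, mul_pow, Real.norm_eq_abs, sq_abs,
    real_inner_comm]
  ring

namespace ParamPolygon

variable {P : ParamPolygon} {r : ℝ}

/-- In the disk about `γ s`, the distance to `γ s` has no local extremum along the rest of the
boundary: at such an extremum a vector of the tangent cone would be orthogonal to the radius. -/
theorem TangentConeGraphLike.crosses (hP : P.TangentConeGraphLike r) {s t : ℝ} (hst : s < t)
    (hts : t < s + P.L) (htr : ‖P.γ t - P.γ s‖ ≤ r) :
    CrossesUp (fun u => ‖P.γ u - P.γ s‖) t ∨ CrossesDown (fun u => ‖P.γ u - P.γ s‖) t := by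
  set d := P.γ t - P.γ s with hd
  have hr : 0 ≤ r := (norm_nonneg _).trans htr
  have hne := P.γ_ne hst hts
  have cone : ∀ α β : ℝ, 0 ≤ α → 0 ≤ β → 0 < α + β →
      α * inner ℝ (P.dirL t) d + β * inner ℝ (P.dirR t) d ≠ 0 := by
    intro α β hα hβ hαβ
    have := hP.inner_ne t hα hβ hαβ (u := t) (v := s) (by simpa using hr)
      (by rwa [norm_sub_rev]) hne
    rwa [inner_add_left, real_inner_smul_left, real_inner_smul_left] at this
  set x := inner ℝ (P.dirL t) d with hx
  set y := inner ℝ (P.dirR t) d with hy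
  obtain ⟨δ, hδ, hR⟩ := P.exists_γ_add_right t
  obtain ⟨δ', hδ', hL⟩ := P.exists_γ_sub_left t
  have hR' : ∀ u ∈ Ioo t (t + δ),
      ‖P.γ u - P.γ s‖ ^ 2 = ‖d‖ ^ 2 + 2 * (u - t) * y + (u - t) ^ 2 := by
    intro u hu
    have := hR (u - t) ⟨by linarith [hu.1], by linarith [hu.2]⟩
    rw [add_sub_cancel] at this
    rw [this, add_sub_right_comm, norm_add_smul_sq, P.norm_dirR]
    ring
  have hL' : ∀ u ∈ Ioo (t - δ') t,
      ‖P.γ u - P.γ s‖ ^ 2 = ‖d‖ ^ 2 - 2 * (t - u) * x + (t - u) ^ 2 := by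
    intro u hu
    have := hL (t - u) ⟨by linarith [hu.2], by linarith [hu.1]⟩
    rw [sub_sub_cancel] at this
    rw [this, sub_eq_add_neg (P.γ t), ← neg_smul, add_sub_right_comm, norm_add_smul_sq, P.norm_dirL]
    ring
  have hx0 : x ≠ 0 := by simpa using cone 1 0 zero_le_one le_rfl (by norm_num)
  have hy0 : y ≠ 0 := by simpa using cone 0 1 le_rfl zero_le_one (by norm_num)
  rcases hx0.lt_or_gt with hx1 | hx1 <;> rcases hy0.lt_or_gt with hy1 | hy1
  · right
    constructor
    · filter_upwards [Ioo_mem_nhdsLT (sub_lt_self t hδ')] with u hu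
      refine lt_of_pow_lt_pow_left₀ 2 (norm_nonneg _) ?_
      rw [hL' u hu]
      nlinarith [hu.2, mul_pos (sub_pos.2 hu.2) (neg_pos.2 hx1)]
    · filter_upwards [Ioo_mem_nhdsGT (lt_add_of_pos_right t hδ),
        Ioo_mem_nhdsGT (show t < t - y by linarith)] with u hu hu'
      refine lt_of_pow_lt_pow_left₀ 2 (norm_nonneg _) ?_
      rw [hR' u hu]
      nlinarith [hu.1, hu'.2]
  · exact absurd (by ring) (cone y (-x) hy1.le (by linarith) (by linarith))
  · exact absurd (by ring) (cone (-y) x (by linarith) hx1.le (by linarith))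
  · left
    constructor
    · filter_upwards [Ioo_mem_nhdsLT (sub_lt_self t hδ'),
        Ioo_mem_nhdsLT (show t - x < t by linarith)] with u hu hu'
      refine lt_of_pow_lt_pow_left₀ 2 (norm_nonneg _) ?_
      rw [hL' u hu]
      nlinarith [hu.2, hu'.1]
    · filter_upwards [Ioo_mem_nhdsGT (lt_add_of_pos_right t hδ)] with u hu
      refine lt_of_pow_lt_pow_left₀ 2 (norm_nonneg _) ?_
      rw [hR' u hu]
      nlinarith [hu.1, mul_pos (sub_pos.2 hu.1) hy1]

/-- The boundary near `γ s`: `γ` leaves the disk of radius `r` about `γ s` at the parameter `p` and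
comes back at the parameter `m`, with the distance to `γ s` increasing up to `p` and decreasing
from `m` on. -/
structure Crossing (P : ParamPolygon) (r s p m : ℝ) : Prop where
  lt_p : s < p
  p_lt_m : p < m
  m_lt : m < s + P.L
  norm_p : ‖P.γ p - P.γ s‖ = r
  norm_m : ‖P.γ m - P.γ s‖ = r
  mono : StrictMonoOn (fun u => ‖P.γ u - P.γ s‖) (Icc s p)
  anti : StrictAntiOn (fun u => ‖P.γ u - P.γ s‖) (Icc m (s + P.L))
  mem_or : ∀ t ∈ Ioo s (s + P.L), ‖P.γ t - P.γ s‖ ≤ r → t ∈ Ioc s p ∨ t ∈ Ico m (s + P.L)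

theorem TangentConeGraphLike.exists_crossing (hP : P.TangentConeGraphLike r) (hr : 0 < r) (s : ℝ) :
    ∃ p m, P.Crossing r s p m := by
  have hc := P.continuous_γ
  obtain ⟨p, m, h1, h2, h3, h4, h5, h6, h7, h8⟩ := exists_rise_fall
    (f := fun u => ‖P.γ u - P.γ s‖) (by fun_prop)
    (fun t ht htr => hP.crosses ht.1 ht.2 htr) (show s < s + P.L by linarith [P.L_pos]) hr
    (by simp) (by simp [P.periodic s])
    (fun t ht => norm_pos_iff.2 (sub_ne_zero.2 (P.γ_ne ht.1 ht.2)))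
  exact ⟨p, m, h1, h2, h3, h4, h5, h6, h7, h8⟩

/-- The exterior angle is less than a right angle everywhere. -/
theorem TangentConeGraphLike.inner_dirL_dirR_pos (hP : P.TangentConeGraphLike r) (hr : 0 < r)
    (s : ℝ) : 0 < inner ℝ (P.dirL s) (P.dirR s) := by
  by_contra! hcon
  obtain ⟨δ, hδ, hR⟩ := P.exists_γ_add_right s
  have hm : 0 < min δ r := lt_min hδ hr
  have e := hR _ ⟨hm.le, min_le_left _ _⟩
  have hn : ‖P.γ (s + min δ r) - P.γ s‖ = min δ r := by
    rw [e, add_sub_cancel_left, norm_smul, P.norm_dirR, mul_one, Real.norm_of_nonneg hm.le]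
  refine hP.inner_ne s (α := 1) (β := -inner ℝ (P.dirL s) (P.dirR s)) zero_le_one (by linarith)
    (by linarith) (u := s + min δ r) (v := s) (hn.trans_le (min_le_right _ _))
    (by simpa using hr.le)
    (sub_ne_zero.1 (norm_pos_iff.1 (hm.trans_eq hn.symm))) ?_
  rw [e, add_sub_cancel_left, real_inner_smul_right, inner_add_left, real_inner_smul_left,
    real_inner_smul_left, real_inner_self_eq_norm_sq, P.norm_dirR]
  ring

/-- On the outgoing branch the boundary lies ahead of `γ s`, for every direction of the cone. -/
theorem Crossing.inner_pos {s p m : ℝ} (hc : P.Crossing r s p m) (hP : P.TangentConeGraphLike r)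
    (hr : 0 < r) {α β : ℝ} (hα : 0 ≤ α) (hβ : 0 ≤ β) (hαβ : 0 < α + β) {t : ℝ} (ht : t ∈ Ioc s p) :
    0 < inner ℝ (α • P.dirL s + β • P.dirR s) (P.γ t - P.γ s) := by
  have hcont := P.continuous_γ
  set w := α • P.dirL s + β • P.dirR s with hw
  have hne : ∀ u ∈ Ioc s p, inner ℝ w (P.γ u - P.γ s) ≠ 0 := by
    intro u hu
    refine hP.inner_ne s hα hβ hαβ ?_ (by simpa using hr.le)
      (P.γ_ne hu.1 (hu.2.trans_lt (hc.p_lt_m.trans hc.m_lt)))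
    rw [← hc.norm_p]
    exact hc.mono.monotoneOn ⟨hu.1.le, hu.2⟩ ⟨hc.lt_p.le, le_rfl⟩ hu.2
  obtain ⟨δ, hδ, hR⟩ := P.exists_γ_add_right s
  have hm : 0 < min δ (p - s) := lt_min hδ (sub_pos.2 hc.lt_p)
  have hpos : 0 < inner ℝ w (P.γ (s + min δ (p - s)) - P.γ s) := by
    rw [hR _ ⟨hm.le, min_le_left _ _⟩, add_sub_cancel_left, real_inner_smul_right, hw,
      inner_add_left, real_inner_smul_left, real_inner_smul_left, real_inner_self_eq_norm_sq,
      P.norm_dirR]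
    have := hP.inner_dirL_dirR_pos hr s
    rcases hα.eq_or_lt with rfl | hα
    · exact mul_pos hm (by linarith)
    · exact mul_pos hm (by nlinarith [mul_pos hα this])
  by_contra! hcon
  obtain ⟨u, hu, hu0⟩ := (isPreconnected_Ioc (a := s) (b := p)).intermediate_value ht
    (show s + min δ (p - s) ∈ Ioc s p from
      ⟨by linarith, by linarith [min_le_right δ (p - s)]⟩)
    (f := fun u => inner ℝ w (P.γ u - P.γ s)) (by fun_prop) ⟨hcon, hpos.le⟩
  exact hne u hu hu0

/-- On the incoming branch the boundary lies behind `γ s`, for every direction of the cone. -/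
theorem Crossing.inner_neg {s p m : ℝ} (hc : P.Crossing r s p m) (hP : P.TangentConeGraphLike r)
    (hr : 0 < r) {α β : ℝ} (hα : 0 ≤ α) (hβ : 0 ≤ β) (hαβ : 0 < α + β) {t : ℝ}
    (ht : t ∈ Ico m (s + P.L)) :
    inner ℝ (α • P.dirL s + β • P.dirR s) (P.γ t - P.γ s) < 0 := by
  have hcont := P.continuous_γ
  set w := α • P.dirL s + β • P.dirR s with hw
  have hne : ∀ u ∈ Ico m (s + P.L), inner ℝ w (P.γ u - P.γ s) ≠ 0 := by
    intro u hu
    refine hP.inner_ne s hα hβ hαβ ?_ (by simpa using hr.le)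
      (P.γ_ne ((hc.lt_p.trans hc.p_lt_m).trans_le hu.1) hu.2)
    rw [← hc.norm_m]
    exact hc.anti.antitoneOn ⟨le_rfl, hc.m_lt.le⟩ ⟨hu.1, hu.2.le⟩ hu.1
  obtain ⟨δ, hδ, hL⟩ := P.exists_γ_sub_left (s + P.L)
  have hm : 0 < min δ (s + P.L - m) := lt_min hδ (sub_pos.2 hc.m_lt)
  have hneg : inner ℝ w (P.γ (s + P.L - min δ (s + P.L - m)) - P.γ s) < 0 := by
    rw [hL _ ⟨hm.le, min_le_left _ _⟩, P.periodic, sub_sub_cancel_left, P.dirL_add_L,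
      inner_neg_right, real_inner_smul_right, hw, inner_add_left, real_inner_smul_left, real_inner_smul_left,
      real_inner_self_eq_norm_sq, P.norm_dirL, real_inner_comm, neg_lt_zero]
    have := hP.inner_dirL_dirR_pos hr s
    rcases hβ.eq_or_lt with rfl | hβ
    · exact mul_pos hm (by linarith)
    · exact mul_pos hm (by nlinarith [mul_pos hβ this])
  by_contra! hcon
  obtain ⟨u, hu, hu0⟩ := (isPreconnected_Ico (a := m) (b := s + P.L)).intermediate_value
    (show s + P.L - min δ (s + P.L - m) ∈ Ico m (s + P.L) from
      ⟨by linarith [min_le_right δ (s + P.L - m)], by linarith⟩) ht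
    (f := fun u => inner ℝ w (P.γ u - P.γ s)) (by fun_prop) ⟨hneg.le, hcon⟩
  exact hne u hu hu0

end ParamPolygon

/-! ### Areas in polar coordinates -/

theorem continuousAt_indicator_one {X : Type*} [TopologicalSpace X] {K : Set X} {z : X}
    (hz : z ∉ frontier K) : ContinuousAt (K.indicator (1 : X → ℝ)) z := by
  by_cases hi : z ∈ interior K
  · refine continuousAt_const (y := (1 : ℝ)) |>.congr ?_
    filter_upwards [mem_interior_iff_mem_nhds.1 hi] with y hy
    simp [hy]
  · have : z ∉ closure K := fun h => hz ⟨h, hi⟩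
    refine continuousAt_const (y := (0 : ℝ)) |>.congr ?_
    filter_upwards [isClosed_closure.isOpen_compl.mem_nhds this] with y hy
    rw [indicator_of_notMem (fun h => hy (subset_closure h))]

theorem integral_comp_add_mul {e : ℂ} (he : ‖e‖ = 1) (c : ℂ) (f : ℂ → ℝ) :
    ∫ z, f (c + e * z) = ∫ z, f z := by
  have h := (rotation ⟨e, by simp [Submonoid.unitSphere, he]⟩).measurePreserving
  rw [← integral_add_left_eq_self f c]
  exact h.integral_comp (Homeomorph.measurableEmbedding
    (rotation ⟨e, by simp [Submonoid.unitSphere, he]⟩).toHomeomorph) (fun z => f (c + z))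

/-- The point with polar coordinates `(ρ, α)` about the centre `c`, angles being measured from the
direction of the unit vector `e`. -/
noncomputable def polarPoint (c e : ℂ) (ρ α : ℝ) : ℂ := c + e * (ρ * Complex.exp (α * Complex.I))

theorem polarPoint_eq (c e : ℂ) (p : ℝ × ℝ) :
    polarPoint c e p.1 p.2 = c + e * Complex.polarCoord.symm p := by
  rw [polarPoint, Complex.polarCoord_symm_apply, Complex.exp_mul_I, Complex.ofReal_cos,
    Complex.ofReal_sin]

theorem continuous_polarPoint (c e : ℂ) : Continuous fun p : ℝ × ℝ => polarPoint c e p.1 p.2 := by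
  unfold polarPoint; fun_prop

theorem toReal_volume_eq_polar {A : Set ℂ} (hA : MeasurableSet A) (c : ℂ) {e : ℂ} (he : ‖e‖ = 1)
    {M : ℝ} (hM : ∀ ρ > 0, ∀ α, polarPoint c e ρ α ∈ A → ρ ≤ M) :
    Integrable (fun α => ∫ ρ in Ioi 0, ρ * A.indicator 1 (polarPoint c e ρ α))
      (volume.restrict (Ioo (-Real.pi) Real.pi)) ∧
    (volume A).toReal = ∫ α in Ioo (-Real.pi) Real.pi,
      ∫ ρ in Ioi 0, ρ * A.indicator 1 (polarPoint c e ρ α) := by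
  have hm : Measurable fun p : ℝ × ℝ => p.1 * A.indicator (1 : ℂ → ℝ) (polarPoint c e p.1 p.2) :=
    measurable_fst.mul ((measurable_one.indicator hA).comp (continuous_polarPoint c e).measurable)
  have hint : Integrable (fun p : ℝ × ℝ => p.1 * A.indicator (1 : ℂ → ℝ) (polarPoint c e p.1 p.2))
      ((volume.restrict (Ioi 0)).prod (volume.restrict (Ioo (-Real.pi) Real.pi))) := by
    rw [Measure.prod_restrict]
    have hfin : volume (Ioc 0 M ×ˢ Ioo (-Real.pi) Real.pi) < ⊤ := by
      rw [Measure.volume_eq_prod, Measure.prod_prod]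
      simp [ENNReal.mul_lt_top_iff]
    have : IntegrableOn (fun p : ℝ × ℝ => p.1 * A.indicator (1 : ℂ → ℝ) (polarPoint c e p.1 p.2))
        (Ioc 0 M ×ˢ Ioo (-Real.pi) Real.pi) (volume.prod volume) := by
      refine Measure.integrableOn_of_bounded (M := M) hfin.ne hm.aestronglyMeasurable ?_
      filter_upwards [ae_restrict_mem (measurableSet_Ioc.prod measurableSet_Ioo)] with p hp
      by_cases h : polarPoint c e p.1 p.2 ∈ A
      · simpa [h, abs_of_pos hp.1.1] using hp.1.2
      · simpa [h] using hp.1.1.le.trans hp.1.2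
    refine this.of_forall_sdiff_eq_zero (measurableSet_Ioi.prod measurableSet_Ioo) fun p hp => ?_
    have : polarPoint c e p.1 p.2 ∉ A := fun h =>
      hp.2 ⟨⟨hp.1.1, hM _ hp.1.1 _ h⟩, hp.1.2⟩
    simp [this]
  refine ⟨hint.integral_prod_right, ?_⟩
  rw [← integral_prod_symm _ hint, Measure.prod_restrict]
  have h1 : (volume A).toReal = ∫ z, A.indicator (1 : ℂ → ℝ) z := by
    rw [integral_indicator_one hA]; rfl
  rw [h1, ← integral_comp_add_mul he c, ← Complex.integral_comp_polarCoord_symm,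
    polarCoord_target, Measure.volume_eq_prod]
  simp only [smul_eq_mul, polarPoint_eq]

/-- **Derivative of an area swept by a family of star-shaped regions.** If `S x` is given in polar
coordinates by `ρ ≤ R x α`, the derivative of the area of `K ∩ S x` at a parameter where `S x` is
the disk of radius `r` is the integral of `r * ∂ₓ R` over the part of the circle that lies in `K`. -/
theorem hasDerivAt_area {K : Set ℂ} (hK : IsCompact K) (c : ℂ) {e : ℂ} (he : ‖e‖ = 1)
    {S : ℝ → Set ℂ} {R : ℝ → ℝ → ℝ} {R' : ℝ → ℝ} {x₀ r M C : ℝ} {U : Set ℝ} (hU : U ∈ 𝓝 x₀)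
    (hS : ∀ x, MeasurableSet (S x))
    (hSR : ∀ x ∈ U, ∀ α, ∀ ρ > 0, polarPoint c e ρ α ∈ S x ↔ ρ ≤ R x α)
    (hR : ∀ x ∈ U, ∀ α, R x α ∈ Icc 0 M)
    (hLip : ∀ x ∈ U, ∀ y ∈ U, ∀ α, |R x α - R y α| ≤ C * |x - y|)
    (hR' : Continuous R') (hRd : ∀ α, HasDerivAt (R · α) (R' α) x₀) (hRr : ∀ α, R x₀ α = r)
    (hfr : ∀ᵐ α ∂volume.restrict (Ioo (-Real.pi) Real.pi), polarPoint c e r α ∉ frontier K) :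
    HasDerivAt (fun x => (volume (K ∩ S x)).toReal)
      (∫ α in Ioo (-Real.pi) Real.pi, r * K.indicator 1 (polarPoint c e r α) * R' α) x₀ := by
  set ind : ℂ → ℝ := K.indicator 1 with hind
  have hx₀ : x₀ ∈ U := mem_of_mem_nhds hU
  have hM : 0 ≤ M := (hR x₀ hx₀ 0).1.trans (hR x₀ hx₀ 0).2
  have hC : 0 ≤ C := by
    obtain ⟨ε, hε, hb⟩ := Metric.mem_nhds_iff.1 hU
    have h := hLip (x₀ + ε / 2) (hb (by simp [abs_of_pos hε, hε])) x₀ hx₀ 0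
    rw [add_sub_cancel_left, abs_of_pos (half_pos hε)] at h
    exact nonneg_of_mul_nonneg_left ((abs_nonneg _).trans h) (half_pos hε)
  have hind1 : ∀ z, |ind z| ≤ 1 := by
    intro z
    by_cases h : z ∈ K <;> simp [hind, h]
  have hmeas : Measurable fun p : ℝ × ℝ => p.1 * ind (polarPoint c e p.1 p.2) :=
    measurable_fst.mul ((measurable_one.indicator hK.measurableSet).comp
      (continuous_polarPoint c e).measurable)
  have hmeas1 : ∀ α, Measurable fun ρ : ℝ => ρ * ind (polarPoint c e ρ α) := fun α =>
    hmeas.comp (measurable_id.prodMk measurable_const)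
  have hii : ∀ α a b, IntervalIntegrable (fun ρ => ρ * ind (polarPoint c e ρ α)) volume a b := by
    intro α a b
    refine (continuous_id (X := ℝ)).norm.intervalIntegrable a b |>.mono_fun
      (hmeas1 α).aestronglyMeasurable (ae_of_all _ fun ρ => ?_)
    simpa [abs_mul] using mul_le_of_le_one_right (abs_nonneg ρ) (hind1 _)
  set F : ℝ → ℝ → ℝ := fun x α => ∫ ρ in (0 : ℝ)..R x α, ρ * ind (polarPoint c e ρ α) with hF
  have hFeq : ∀ x ∈ U, ∀ α, F x α =
      ∫ ρ in Ioi 0, ρ * (K ∩ S x).indicator 1 (polarPoint c e ρ α) := by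
    intro x hx α
    simp only [hF]
    rw [intervalIntegral.integral_of_le (hR x hx α).1, ← Ioi_inter_Iic,
      ← setIntegral_indicator measurableSet_Iic]
    refine setIntegral_congr_fun measurableSet_Ioi fun ρ hρ => ?_
    by_cases h : ρ ≤ R x α
    · have h2 := (hSR x hx α ρ hρ).2 h
      by_cases h1 : polarPoint c e ρ α ∈ K <;> simp [hind, h, h1, h2]
    · have h2 : polarPoint c e ρ α ∉ K ∩ S x := fun h' => h ((hSR x hx α ρ hρ).1 h'.2)
      simp [h, indicator_of_notMem h2]
  have hpol := fun x (hx : x ∈ U) => toReal_volume_eq_polar (hK.measurableSet.inter (hS x)) c he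
    (M := M) (fun ρ hρ α h => ((hSR x hx α ρ hρ).1 h.2).trans (hR x hx α).2)
  have hFint : ∀ x ∈ U, Integrable (F x) (volume.restrict (Ioo (-Real.pi) Real.pi)) := by
    intro x hx
    rw [funext (hFeq x hx)]
    exact (hpol x hx).1
  have key := hasDerivAt_integral_of_dominated_loc_of_lip (𝕜 := ℝ)
    (μ := volume.restrict (Ioo (-Real.pi) Real.pi)) (F := F) (x₀ := x₀) (s := U)
    (F' := fun α => r * ind (polarPoint c e r α) * R' α)
    (bound := fun _ => M * C) hU ?_ (hFint x₀ hx₀) ?_ ?_ ?_ ?_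
  · refine key.2.congr_of_eventuallyEq ?_
    filter_upwards [hU] with x hx
    rw [(hpol x hx).2]
    simp only [hFeq x hx]
  · filter_upwards [hU] with x hx using (hFint x hx).aestronglyMeasurable
  · exact ((hmeas.comp (measurable_const (a := r) |>.prodMk measurable_id)).mul
      hR'.measurable).aestronglyMeasurable
  · refine ae_of_all _ fun α => LipschitzOnWith.of_dist_le_mul fun x hx y hy => ?_
    rw [Real.dist_eq, Real.dist_eq, hF]
    simp only
    rw [intervalIntegral.integral_interval_sub_left (hii _ _ _) (hii _ _ _),
      Real.coe_nnabs, abs_of_nonneg (mul_nonneg hM hC), mul_assoc]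
    rw [← Real.norm_eq_abs]
    refine (intervalIntegral.norm_integral_le_of_norm_le_const (C := M) fun ρ hρ => ?_).trans
      (mul_le_mul_of_nonneg_left (hLip x hx y hy α) hM)
    have h1 := hR x hx α
    have h2 := hR y hy α
    rw [uIoc_eq_union] at hρ
    have : |ρ| ≤ M := abs_le.2 (by
      rcases hρ with hρ | hρ <;> constructor <;> linarith [hρ.1, hρ.2, h1.1, h1.2, h2.1, h2.2])
    rw [Real.norm_eq_abs, abs_mul]
    exact (mul_le_of_le_one_right (abs_nonneg ρ) (hind1 _)).trans this
  · exact integrable_const _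
  · filter_upwards [hfr] with α hα
    have hcont : ContinuousAt (fun ρ : ℝ => ρ * ind (polarPoint c e ρ α)) r := by
      refine continuousAt_id.mul (ContinuousAt.comp (f := fun ρ => polarPoint c e ρ α)
        (continuousAt_indicator_one hα) ?_)
      exact ((continuous_polarPoint c e).comp (continuous_id.prodMk continuous_const)).continuousAt
    have h1 := intervalIntegral.integral_hasDerivAt_right (hii α 0 r)
      ((hmeas1 α).stronglyMeasurable.stronglyMeasurableAtFilter) hcont
    have h2 := HasDerivAt.comp_of_eq x₀ h1 (hRd α) (hRr α).symm
    exact h2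

/-- The derivative of the area of `K` in a disk with respect to the radius. -/
theorem hasDerivAt_area_radius {K : Set ℂ} (hK : IsCompact K) (c : ℂ) {e : ℂ} (he : ‖e‖ = 1) {r : ℝ}
    (hr : 0 < r)
    (hfr : ∀ᵐ α ∂volume.restrict (Ioo (-Real.pi) Real.pi), polarPoint c e r α ∉ frontier K) :
    HasDerivAt (fun ρ => (volume (K ∩ Metric.closedBall c ρ)).toReal)
      (∫ α in Ioo (-Real.pi) Real.pi, r * K.indicator 1 (polarPoint c e r α)) r := by
  have := hasDerivAt_area hK c he (S := fun x => Metric.closedBall c x) (R := fun x _ => x)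
    (R' := fun _ => 1) (M := 2 * r) (C := 1) (U := Ioo 0 (2 * r))
    (Ioo_mem_nhds hr (by linarith)) (fun x => Metric.isClosed_closedBall.measurableSet)
    (fun x _ α ρ hρ => by simp [polarPoint, he, Complex.norm_exp_ofReal_mul_I, abs_of_pos hρ])
    (fun x hx _ => ⟨hx.1.le, hx.2.le⟩) (fun x _ y _ _ => by rw [one_mul]) continuous_const
    (fun _ => hasDerivAt_id r) (fun _ => rfl) hfr
  simpa only [mul_one] using this

/-- The derivative of the area of `K` in a disk when the centre moves in the unit direction `v`. -/
theorem hasDerivAt_area_center {K : Set ℂ} (hK : IsCompact K) (c : ℂ) {e v : ℂ} (he : ‖e‖ = 1)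
    (hv : ‖v‖ = 1) {r : ℝ} (hr : 0 < r)
    (hfr : ∀ᵐ α ∂volume.restrict (Ioo (-Real.pi) Real.pi), polarPoint c e r α ∉ frontier K) :
    HasDerivAt (fun h : ℝ => (volume (K ∩ Metric.closedBall (c + h • v) r)).toReal)
      (∫ α in Ioo (-Real.pi) Real.pi, r * K.indicator 1 (polarPoint c e r α) *
        inner ℝ v (e * Complex.exp (α * Complex.I))) 0 := by
  -- `A α` and `B α` are the coordinates of `v` along and across the ray with angle `α`
  set A : ℝ → ℝ := fun α => inner ℝ v (e * Complex.exp (α * Complex.I)) with hA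
  have hA1 : ∀ α, A α ^ 2 ≤ 1 := by
    intro α
    have := abs_real_inner_le_norm v (e * Complex.exp (α * Complex.I))
    rw [hv, norm_mul, he, Complex.norm_exp_ofReal_mul_I, mul_one, mul_one] at this
    rw [sq_le_one_iff_abs_le_one]; exact this
  have hnorm : ∀ (h ρ α : ℝ), ‖polarPoint c e ρ α - (c + h • v)‖ ^ 2 =
      ρ ^ 2 - 2 * ρ * h * A α + h ^ 2 := by
    intro h ρ α
    have : polarPoint c e ρ α - (c + h • v) =
        ρ • (e * Complex.exp (α * Complex.I)) + (-h) • v := by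
      simp [polarPoint]; ring
    rw [this, norm_add_smul_sq, real_inner_smul_right, hv, norm_smul, norm_mul, he,
      Complex.norm_exp_ofReal_mul_I, mul_pow, Real.norm_eq_abs, sq_abs]
    ring
  have hsq : ∀ x ∈ Ioo (-(r / 2)) (r / 2), x ^ 2 ≤ r ^ 2 / 4 := fun x hx => by
    nlinarith [hx.1, hx.2]
  set D : ℝ → ℝ → ℝ := fun x α => r ^ 2 - x ^ 2 * (1 - A α ^ 2) with hD
  have hD0 : ∀ x ∈ Ioo (-(r / 2)) (r / 2), ∀ α, r ^ 2 / 4 ≤ D x α := by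
    intro x hx α
    have := hsq x hx
    have h1 := hA1 α
    simp only [hD]
    nlinarith [sq_nonneg x, sq_nonneg (A α), mul_nonneg (sq_nonneg x) (sq_nonneg (A α))]
  have hDs : ∀ x ∈ Ioo (-(r / 2)) (r / 2), ∀ α, r / 2 ≤ √(D x α) := by
    intro x hx α
    refine Real.le_sqrt_of_sq_le ?_
    linarith [hD0 x hx α, show (r / 2) ^ 2 = r ^ 2 / 4 by ring]
  have hDss : ∀ x ∈ Ioo (-(r / 2)) (r / 2), ∀ α, √(D x α) ^ 2 = D x α := fun x hx α =>
    Real.sq_sqrt ((by positivity : (0 : ℝ) ≤ r ^ 2 / 4).trans (hD0 x hx α))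
  have hAabs : ∀ α, |A α| ≤ 1 := fun α => (sq_le_one_iff_abs_le_one _).1 (hA1 α)
  have hxA : ∀ x ∈ Ioo (-(r / 2)) (r / 2), ∀ α, |x * A α| ≤ r / 2 := by
    intro x hx α
    rw [abs_mul]
    exact (mul_le_of_le_one_right (abs_nonneg x) (hAabs α)).trans (abs_le.2 ⟨hx.1.le, hx.2.le⟩)
  refine hasDerivAt_area hK c he (S := fun h => Metric.closedBall (c + h • v) r)
    (R := fun x α => x * A α + √(D x α)) (M := 2 * r) (C := 3)
    (U := Ioo (-(r / 2)) (r / 2)) (Ioo_mem_nhds (by linarith) (by linarith))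
    (fun x => Metric.isClosed_closedBall.measurableSet) ?_ ?_ ?_ (by fun_prop) ?_ ?_ hfr
  · intro x hx α ρ hρ
    have h1 := abs_le.1 (hxA x hx α)
    have h2 := hDs x hx α
    have h3 := hDss x hx α
    rw [mem_closedBall_iff_norm, ← sq_le_sq₀ (norm_nonneg _) hr.le, hnorm]
    simp only [hD] at h3
    -- the quadratic inequality in `ρ` has one negative and one positive root
    have h4 : ρ ^ 2 - 2 * ρ * x * A α + x ^ 2 - r ^ 2 =
        (ρ - x * A α - √(D x α)) * (ρ - x * A α + √(D x α)) := by
      linear_combination h3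
    rw [← sub_nonpos, h4]
    have h5 : 0 < ρ - x * A α + √(D x α) := by
      by_contra! hcon
      have hxr := hsq x hx
      nlinarith [hx.1, hx.2]
    constructor
    · intro h
      have := nonpos_of_mul_nonpos_left h h5
      linarith
    · intro h
      exact mul_nonpos_of_nonpos_of_nonneg (by linarith) h5.le
  · intro x hx α
    have h1 := abs_le.1 (hxA x hx α)
    have h2 := hDs x hx α
    have h3 : √(D x α) ≤ r := by
      refine Real.sqrt_le_iff.2 ⟨hr.le, ?_⟩
      simp only [hD]
      nlinarith [sq_nonneg x, hA1 α]
    constructor <;> linarith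
  · intro x hx y hy α
    have hx2 := hDs x hx α
    have hy2 := hDs y hy α
    have e1 : (√(D x α) - √(D y α)) * (√(D x α) + √(D y α)) =
        (y - x) * ((y + x) * (1 - A α ^ 2)) := by
      have h3 := hDss x hx α
      have h4 := hDss y hy α
      simp only [hD] at h3 h4 ⊢
      linear_combination h3 - h4
    have hB : |(y + x) * (1 - A α ^ 2)| ≤ r := by
      rw [abs_mul, abs_of_nonneg (sub_nonneg.2 (hA1 α))]
      have : |y + x| ≤ r := abs_le.2 ⟨by linarith [hx.1, hy.1], by linarith [hx.2, hy.2]⟩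
      exact (mul_le_of_le_one_right (abs_nonneg _) (by linarith [sq_nonneg (A α)])).trans this
    have e2 : |√(D x α) - √(D y α)| ≤ |x - y| := by
      have h5 := congrArg abs e1
      rw [abs_mul, abs_mul, abs_of_pos (by linarith : 0 < √(D x α) + √(D y α)), abs_sub_comm y x]
        at h5
      by_contra! hcon
      have h6 := mul_le_mul_of_nonneg_left hB (abs_nonneg (x - y))
      nlinarith [abs_nonneg (x - y)]
    calc |x * A α + √(D x α) - (y * A α + √(D y α))|
        = |(x - y) * A α + (√(D x α) - √(D y α))| := by ring_nf
      _ ≤ |(x - y) * A α| + |√(D x α) - √(D y α)| := abs_add_le _ _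
      _ ≤ |x - y| * 1 + |x - y| := by
          rw [abs_mul]
          exact add_le_add (mul_le_mul_of_nonneg_left (hAabs α) (abs_nonneg _)) e2
      _ ≤ 3 * |x - y| := by linarith [abs_nonneg (x - y)]
  · intro α
    have h1 : HasDerivAt (fun x => D x α) (-(2 * 0 * (1 - A α ^ 2))) 0 := by
      have := ((hasDerivAt_pow 2 (0 : ℝ)).mul_const (1 - A α ^ 2)).const_sub (r ^ 2)
      simpa using this
    have h2 := h1.sqrt (by simp [hD, hr.ne'])
    have h3 := ((hasDerivAt_id (0 : ℝ)).mul_const (A α)).add h2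
    rw [mul_zero, zero_mul, neg_zero, zero_div, add_zero, one_mul] at h3
    exact h3
  · intro α
    simp [hD, Real.sqrt_sq hr.le]

/-! ### The part of a circle inside a region bounded by two branches -/

theorem IsPreconnected.subset_interior_of_frontier {X : Type*} [TopologicalSpace X] {s K : Set X}
    (hs : IsPreconnected s) (hd : ∀ x ∈ s, x ∉ frontier K) (hne : ∃ x ∈ s, x ∈ K) :
    s ⊆ interior K := by
  have hint : ∀ x ∈ s, x ∈ closure K → x ∈ interior K := fun x hx hc => by
    by_contra h
    exact hd x hx ⟨hc, h⟩
  refine hs.subset_left_of_subset_union isOpen_interior isClosed_closure.isOpen_compl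
    (disjoint_compl_right.mono_left (interior_subset.trans subset_closure)) (fun x hx => ?_) ?_
  · by_cases h : x ∈ closure K
    exacts [Or.inl (hint x hx h), Or.inr h]
  · obtain ⟨x, hx, hK⟩ := hne
    exact ⟨x, hx, hint x hx (subset_closure hK)⟩

/-- The frontier of `K` near the origin, in the disk of radius `r`: two branches `κ '' I₁` in the
lower and `κ '' I₂` in the upper half plane, each meeting every circle about the origin once. -/
structure TwoBranches (K : Set ℂ) (r : ℝ) (I₁ I₂ : Set ℝ) (κ : ℝ → ℂ) : Prop where
  isClosed : IsClosed K
  zero_mem : 0 ∈ frontier K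
  preconnected₁ : IsPreconnected I₁
  preconnected₂ : IsPreconnected I₂
  continuous : Continuous κ
  im_neg : ∀ t ∈ I₁, (κ t).im < 0
  im_pos : ∀ t ∈ I₂, 0 < (κ t).im
  injOn₁ : InjOn (fun t => ‖κ t‖) I₁
  injOn₂ : InjOn (fun t => ‖κ t‖) I₂
  surj₁ : ∀ ρ ∈ Ioc 0 r, ∃ t ∈ I₁, ‖κ t‖ = ρ
  surj₂ : ∀ ρ ∈ Ioc 0 r, ∃ t ∈ I₂, ‖κ t‖ = ρ
  le₁ : ∀ t ∈ I₁, ‖κ t‖ ≤ r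
  le₂ : ∀ t ∈ I₂, ‖κ t‖ ≤ r
  mem₁ : ∀ t ∈ I₁, κ t ∈ frontier K
  mem₂ : ∀ t ∈ I₂, κ t ∈ frontier K
  cover : ∀ z ∈ frontier K, z ≠ 0 → ‖z‖ ≤ r → z ∈ κ '' I₁ ∪ κ '' I₂

theorem arg_conj_of_im_ne_zero {z : ℂ} (hz : z.im ≠ 0) :
    (starRingEnd ℂ z).arg = -z.arg := by
  rw [Complex.arg_conj, if_neg]
  intro h
  exact hz (Complex.arg_eq_pi_iff.1 h).2

theorem conj_mul_exp (ρ θ : ℝ) : starRingEnd ℂ (ρ * Complex.exp (θ * Complex.I)) =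
    ρ * Complex.exp ((-θ : ℝ) * Complex.I) := by
  rw [map_mul, Complex.conj_ofReal, ← Complex.exp_conj, map_mul, Complex.conj_ofReal,
    Complex.conj_I]
  push_cast; ring_nf

theorem im_mul_exp (ρ θ : ℝ) : (ρ * Complex.exp (θ * Complex.I)).im = ρ * Real.sin θ := by
  rw [Complex.im_ofReal_mul, Complex.exp_ofReal_mul_I_im]

theorem norm_mul_exp {ρ : ℝ} (hρ : 0 ≤ ρ) (θ : ℝ) : ‖ρ * Complex.exp (θ * Complex.I)‖ = ρ := by
  rw [norm_mul, Complex.norm_exp_ofReal_mul_I, mul_one, Complex.norm_real, Real.norm_of_nonneg hρ]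

theorem arg_mul_exp {ρ θ : ℝ} (hρ : 0 < ρ) (hθ : θ ∈ Ioc (-Real.pi) Real.pi) :
    (ρ * Complex.exp (θ * Complex.I)).arg = θ := by
  rw [Complex.exp_mul_I, Complex.arg_mul_cos_add_sin_mul_I hρ hθ]

namespace TwoBranches

variable {K : Set ℂ} {r : ℝ} {I₁ I₂ : Set ℝ} {κ : ℝ → ℂ}

/-- Reflection in the real axis exchanges the two branches. -/
theorem conj (h : TwoBranches K r I₁ I₂ κ) :
    TwoBranches (starRingEnd ℂ ⁻¹' K) r I₂ I₁ (fun t => starRingEnd ℂ (κ t)) := by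
  have hf : frontier (starRingEnd ℂ ⁻¹' K) = starRingEnd ℂ ⁻¹' frontier K :=
    (Complex.conjCLE.toHomeomorph.preimage_frontier K).symm
  refine ⟨h.isClosed.preimage Complex.continuous_conj, ?_, h.preconnected₂, h.preconnected₁,
    Complex.continuous_conj.comp h.continuous, ?_, ?_, ?_, ?_, ?_, ?_, ?_, ?_, ?_, ?_, ?_⟩
  · simpa [hf] using h.zero_mem
  · simpa using h.im_pos
  · simpa using h.im_neg
  · simpa using h.injOn₂
  · simpa using h.injOn₁
  · simpa using h.surj₂
  · simpa using h.surj₁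
  · simpa using h.le₂
  · simpa using h.le₁
  · simpa [hf] using h.mem₂
  · simpa [hf] using h.mem₁
  · intro z hz hz0 hzr
    rw [hf] at hz
    rcases h.cover _ hz (by simpa using hz0) (by simpa using hzr) with ⟨t, ht, e⟩ | ⟨t, ht, e⟩
    · exact Or.inr ⟨t, ht, by simp [e]⟩
    · exact Or.inl ⟨t, ht, by simp [e]⟩

theorem arg_mem₁ (h : TwoBranches K r I₁ I₂ κ) {t : ℝ} (ht : t ∈ I₁) :
    (κ t).arg ∈ Ioo (-Real.pi) 0 :=
  ⟨Complex.neg_pi_lt_arg _, Complex.arg_neg_iff.2 (h.im_neg t ht)⟩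

theorem arg_mem₂ (h : TwoBranches K r I₁ I₂ κ) {t : ℝ} (ht : t ∈ I₂) :
    (κ t).arg ∈ Ioo 0 Real.pi := by
  have := h.conj.arg_mem₁ ht
  rw [arg_conj_of_im_ne_zero (h.im_pos t ht).ne'] at this
  exact ⟨by linarith [this.2], by linarith [this.1]⟩

theorem norm_pos₁ (h : TwoBranches K r I₁ I₂ κ) {t : ℝ} (ht : t ∈ I₁) : 0 < ‖κ t‖ := by
  rw [norm_pos_iff]
  intro e
  simpa [e] using h.im_neg t ht

theorem notMem_frontier₁ (h : TwoBranches K r I₁ I₂ κ) {t θ : ℝ} (ht : t ∈ I₁)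
    (hθ : θ ∈ Icc (-Real.pi) 0) (hne : θ ≠ (κ t).arg) :
    ‖κ t‖ * Complex.exp (θ * Complex.I) ∉ frontier K := by
  intro hz
  have hpos := h.norm_pos₁ ht
  have hn := norm_mul_exp hpos.le θ
  have him := im_mul_exp ‖κ t‖ θ
  have hs := Real.sin_nonpos_of_nonpos_of_neg_pi_le hθ.2 hθ.1
  rcases h.cover _ hz (norm_pos_iff.1 (by rwa [hn])) (hn.trans_le (h.le₁ t ht)) with
    ⟨u, hu, e⟩ | ⟨u, hu, e⟩
  · obtain rfl : u = t := h.injOn₁ hu ht (by simpa [hn] using congrArg norm e)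
    rcases hθ.1.eq_or_lt with rfl | hlt
    · have := h.im_neg u hu
      rw [e, him] at this
      simp at this
    · rw [e, arg_mul_exp hpos ⟨hlt, hθ.2.trans Real.pi_pos.le⟩] at hne
      exact hne rfl
  · have := h.im_pos u hu
    rw [e, him] at this
    nlinarith

/-- The sector between the branch `I₁` and a ray avoiding it is connected and disjoint from the
frontier of `K`, so it lies in `K` as soon as one of its points does. The points of the sector are
written with angle `(1 - l) * arg (κ t) + l * β`, `0 < l ≤ 1`. -/
theorem mem_of_mem_sector₁ (h : TwoBranches K r I₁ I₂ κ) {β : ℝ} (hβ : β ∈ Icc (-Real.pi) 0)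
    (hne : ∀ t ∈ I₁, β ≠ (κ t).arg) {t u l k : ℝ} (ht : t ∈ I₁) (hu : u ∈ I₁)
    (hl : l ∈ Ioc 0 1) (hk : k ∈ Ioc 0 1)
    (hmem : ‖κ t‖ * Complex.exp (((1 - l) * (κ t).arg + l * β : ℝ) * Complex.I) ∈ K) :
    ‖κ u‖ * Complex.exp (((1 - k) * (κ u).arg + k * β : ℝ) * Complex.I) ∈ K := by
  set f : ℝ × ℝ → ℂ := fun q =>
    ‖κ q.1‖ * Complex.exp (((1 - q.2) * (κ q.1).arg + q.2 * β : ℝ) * Complex.I) with hf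
  have hdisj : ∀ q ∈ I₁ ×ˢ Ioc (0 : ℝ) 1, f q ∉ frontier K := by
    rintro ⟨x, y⟩ ⟨hx, hy⟩
    simp only at hx hy
    have ha := h.arg_mem₁ hx
    refine h.notMem_frontier₁ hx ⟨?_, ?_⟩ fun e => hne x hx ?_
    · nlinarith [hy.1, hy.2, hβ.1, ha.1]
    · nlinarith [hy.1, hy.2, hβ.2, ha.2]
    · have : y * (β - (κ x).arg) = 0 := by linear_combination e
      exact sub_eq_zero.1 ((mul_eq_zero.1 this).resolve_left hy.1.ne')
  have hcont : ContinuousOn f (I₁ ×ˢ Ioc (0 : ℝ) 1) := by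
    have harg : ContinuousOn (fun q : ℝ × ℝ => (κ q.1).arg) (I₁ ×ˢ Ioc (0 : ℝ) 1) := by
      intro q hq
      have hs : κ q.1 ∈ Complex.slitPlane := Or.inr (h.im_neg _ hq.1).ne
      exact ((Complex.continuousAt_arg hs).comp (f := fun q : ℝ × ℝ => κ q.1)
        (h.continuous.comp continuous_fst).continuousAt).continuousWithinAt
    have hk := h.continuous
    fun_prop
  have hpre : IsPreconnected (f '' (I₁ ×ˢ Ioc (0 : ℝ) 1)) :=
    (h.preconnected₁.prod isPreconnected_Ioc).image f hcont
  exact interior_subset (hpre.subset_interior_of_frontier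
    (by rintro _ ⟨q, hq, rfl⟩; exact hdisj q hq) ⟨_, ⟨(t, l), ⟨ht, hl⟩, rfl⟩, hmem⟩
    ⟨(u, k), ⟨hu, hk⟩, rfl⟩)

theorem mem_of_mem_sector₂ (h : TwoBranches K r I₁ I₂ κ) {β : ℝ} (hβ : β ∈ Icc 0 Real.pi)
    (hne : ∀ t ∈ I₂, β ≠ (κ t).arg) {t u l k : ℝ} (ht : t ∈ I₂) (hu : u ∈ I₂)
    (hl : l ∈ Ioc 0 1) (hk : k ∈ Ioc 0 1)
    (hmem : ‖κ t‖ * Complex.exp (((1 - l) * (κ t).arg + l * β : ℝ) * Complex.I) ∈ K) :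
    ‖κ u‖ * Complex.exp (((1 - k) * (κ u).arg + k * β : ℝ) * Complex.I) ∈ K := by
  have harg : ∀ t ∈ I₂, (starRingEnd ℂ (κ t)).arg = -(κ t).arg := fun t ht =>
    arg_conj_of_im_ne_zero (h.im_pos t ht).ne'
  have := h.conj.mem_of_mem_sector₁ (β := -β) ⟨neg_le_neg hβ.2, neg_nonpos.2 hβ.1⟩
    (fun t ht => by rw [harg t ht]; exact fun e => hne t ht (neg_injective e)) ht hu hl hk
  rw [harg t ht, harg u hu, mem_preimage, mem_preimage, conj_mul_exp, conj_mul_exp] at this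
  simp only [RCLike.norm_conj] at this
  convert this ?_ using 5
  · ring
  · convert hmem using 5
    ring

theorem exists_affine_coord {a θ β : ℝ} (h : θ ∈ Ioc a β ∨ θ ∈ Ico β a) :
    ∃ l ∈ Ioc (0 : ℝ) 1, θ = (1 - l) * a + l * β := by
  have hne : β - a ≠ 0 := by
    intro e
    rcases h with h | h <;> linarith [h.1, h.2]
  refine ⟨(θ - a) / (β - a), ?_, by field_simp; ring⟩
  rcases h with h | h
  · have : 0 < β - a := by linarith [h.1, h.2]
    exact ⟨div_pos (by linarith [h.1]) this, (div_le_one this).2 (by linarith [h.2])⟩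
  · have : β - a < 0 := by linarith [h.1, h.2]
    exact ⟨div_pos_of_neg_of_neg (by linarith [h.2]) this,
      (div_le_one_of_neg this).2 (by linarith [h.1])⟩

/-- A circle about the origin meets `K` exactly in the arc above the two branches, provided one
point above the branch `I₁` lies in `K`. -/
theorem mem_iff (h : TwoBranches K r I₁ I₂ κ) (hr : 0 < r) {t₀ θ₀ : ℝ} (ht₀ : t₀ ∈ I₁)
    (hθ₀ : θ₀ ∈ Ioc (κ t₀).arg 0) (hseed : ‖κ t₀‖ * Complex.exp (θ₀ * Complex.I) ∈ K)
    {p m : ℝ} (hp : p ∈ I₁) (hpr : ‖κ p‖ = r) (hm : m ∈ I₂) (hmr : ‖κ m‖ = r)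
    {θ : ℝ} (hθ : θ ∈ Ioo (-Real.pi) Real.pi) :
    r * Complex.exp (θ * Complex.I) ∈ K ↔ θ ∈ Icc (κ p).arg (κ m).arg := by
  have hpi := Real.pi_pos
  have one : (1 : ℝ) ∈ Ioc (0 : ℝ) 1 := ⟨one_pos, le_rfl⟩
  have up₁ : ∀ {t u θ η : ℝ}, t ∈ I₁ → u ∈ I₁ → θ ∈ Ioc (κ t).arg 0 → η ∈ Ioc (κ u).arg 0 →
      ‖κ t‖ * Complex.exp (θ * Complex.I) ∈ K → ‖κ u‖ * Complex.exp (η * Complex.I) ∈ K := by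
    intro t u θ η ht hu hθ hη hmem
    obtain ⟨l, hl, rfl⟩ := exists_affine_coord (Or.inl hθ)
    obtain ⟨k, hk, rfl⟩ := exists_affine_coord (Or.inl hη)
    exact h.mem_of_mem_sector₁ ⟨by linarith, le_rfl⟩ (fun t ht => (h.arg_mem₁ ht).2.ne')
      ht hu hl hk hmem
  have down₁ : ∀ {t u θ η : ℝ}, t ∈ I₁ → u ∈ I₁ → θ ∈ Ico (-Real.pi) (κ t).arg →
      η ∈ Ico (-Real.pi) (κ u).arg →
      ‖κ t‖ * Complex.exp (θ * Complex.I) ∈ K → ‖κ u‖ * Complex.exp (η * Complex.I) ∈ K := by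
    intro t u θ η ht hu hθ hη hmem
    obtain ⟨l, hl, rfl⟩ := exists_affine_coord (Or.inr hθ)
    obtain ⟨k, hk, rfl⟩ := exists_affine_coord (Or.inr hη)
    exact h.mem_of_mem_sector₁ ⟨le_rfl, by linarith⟩ (fun t ht => (h.arg_mem₁ ht).1.ne)
      ht hu hl hk hmem
  have up₂ : ∀ {t u θ η : ℝ}, t ∈ I₂ → u ∈ I₂ → θ ∈ Ico 0 (κ t).arg → η ∈ Ico 0 (κ u).arg →
      ‖κ t‖ * Complex.exp (θ * Complex.I) ∈ K → ‖κ u‖ * Complex.exp (η * Complex.I) ∈ K := by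
    intro t u θ η ht hu hθ hη hmem
    obtain ⟨l, hl, rfl⟩ := exists_affine_coord (Or.inr hθ)
    obtain ⟨k, hk, rfl⟩ := exists_affine_coord (Or.inr hη)
    exact h.mem_of_mem_sector₂ ⟨le_rfl, by linarith⟩ (fun t ht => (h.arg_mem₂ ht).1.ne)
      ht hu hl hk hmem
  have down₂ : ∀ {t u θ η : ℝ}, t ∈ I₂ → u ∈ I₂ → θ ∈ Ioc (κ t).arg Real.pi →
      η ∈ Ioc (κ u).arg Real.pi →
      ‖κ t‖ * Complex.exp (θ * Complex.I) ∈ K → ‖κ u‖ * Complex.exp (η * Complex.I) ∈ K := by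
    intro t u θ η ht hu hθ hη hmem
    obtain ⟨l, hl, rfl⟩ := exists_affine_coord (Or.inl hθ)
    obtain ⟨k, hk, rfl⟩ := exists_affine_coord (Or.inl hη)
    exact h.mem_of_mem_sector₂ ⟨by linarith, le_rfl⟩ (fun t ht => (h.arg_mem₂ ht).2.ne')
      ht hu hl hk hmem
  have hKf := h.isClosed.frontier_subset
  have polar : ∀ z : ℂ, ‖z‖ * Complex.exp (z.arg * Complex.I) = z := Complex.norm_mul_exp_arg_mul_I
  have hpa := h.arg_mem₁ hp
  have hma := h.arg_mem₂ hm
  -- the two upper sectors share the positive real axis, and the seed lies in one of them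
  have upper₁ : ∀ {u η : ℝ}, u ∈ I₁ → η ∈ Ioc (κ u).arg 0 →
      ‖κ u‖ * Complex.exp (η * Complex.I) ∈ K := fun hu hη => up₁ ht₀ hu hθ₀ hη hseed
  have upper₂ : ∀ {u η : ℝ}, u ∈ I₂ → η ∈ Ico 0 (κ u).arg →
      ‖κ u‖ * Complex.exp (η * Complex.I) ∈ K := fun hu hη => by
    refine up₂ hm hu ⟨le_rfl, hma.1⟩ hη ?_
    rw [hmr, ← hpr]
    exact upper₁ hp ⟨hpa.2, le_rfl⟩
  -- the two lower sectors share the negative real axis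
  have hexp : Complex.exp ((-Real.pi : ℝ) * Complex.I) =
      Complex.exp ((Real.pi : ℝ) * Complex.I) := by
    rw [Complex.ofReal_neg, neg_mul, Complex.exp_neg, Complex.exp_pi_mul_I]
    norm_num
  -- if a lower sector met `K`, then `K` would contain a neighbourhood of the frontier point `0`
  have hneg : r * Complex.exp ((Real.pi : ℝ) * Complex.I) ∉ K := by
    intro hmem
    have lower₁ : ∀ {u η : ℝ}, u ∈ I₁ → η ∈ Ico (-Real.pi) (κ u).arg →
        ‖κ u‖ * Complex.exp (η * Complex.I) ∈ K := fun hu hη => by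
      refine down₁ hp hu ⟨le_rfl, hpa.1⟩ hη ?_
      rwa [hpr, hexp]
    have lower₂ : ∀ {u η : ℝ}, u ∈ I₂ → η ∈ Ioc (κ u).arg Real.pi →
        ‖κ u‖ * Complex.exp (η * Complex.I) ∈ K := fun hu hη => by
      refine down₂ hm hu ⟨hma.2, le_rfl⟩ hη ?_
      rwa [hmr]
    refine h.zero_mem.2 (mem_interior_iff_mem_nhds.2 ?_)
    filter_upwards [Metric.ball_mem_nhds 0 hr] with z hz
    rw [mem_ball_zero_iff] at hz
    rcases eq_or_ne z 0 with rfl | hz0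
    · exact hKf h.zero_mem
    have hz1 := norm_pos_iff.2 hz0
    rw [← polar z]
    rcases le_or_gt z.arg 0 with hle | hgt
    · obtain ⟨t, ht, e⟩ := h.surj₁ ‖z‖ ⟨hz1, hz.le⟩
      rw [← e]
      rcases lt_trichotomy z.arg (κ t).arg with h1 | h1 | h1
      · exact lower₁ ht ⟨(Complex.neg_pi_lt_arg z).le, h1⟩
      · rw [h1, polar]; exact hKf (h.mem₁ t ht)
      · exact upper₁ ht ⟨h1, hle⟩
    · obtain ⟨t, ht, e⟩ := h.surj₂ ‖z‖ ⟨hz1, hz.le⟩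
      rw [← e]
      rcases lt_trichotomy z.arg (κ t).arg with h1 | h1 | h1
      · exact upper₂ ht ⟨hgt.le, h1⟩
      · rw [h1, polar]; exact hKf (h.mem₂ t ht)
      · exact lower₂ ht ⟨h1, Complex.arg_le_pi z⟩
  constructor
  · intro hmem
    constructor
    · by_contra! hlt
      refine hneg ?_
      rw [← hexp, ← hpr]
      rw [← hpr] at hmem
      exact down₁ hp hp ⟨hθ.1.le, hlt⟩ ⟨le_rfl, hpa.1⟩ hmem
    · by_contra! hlt
      refine hneg ?_
      rw [← hmr]
      rw [← hmr] at hmem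
      exact down₂ hm hm ⟨hlt, hθ.2.le⟩ ⟨hma.2, le_rfl⟩ hmem
  · rintro ⟨h1, h2⟩
    rcases le_or_gt θ 0 with hle | hgt
    · rw [← hpr]
      rcases h1.eq_or_lt with h1 | h1
      · rw [← h1, polar]; exact hKf (h.mem₁ p hp)
      · exact upper₁ hp ⟨h1, hle⟩
    · rw [← hmr]
      rcases h2.eq_or_lt with h2 | h2
      · rw [h2, polar]; exact hKf (h.mem₂ m hm)
      · exact upper₂ hm ⟨hgt.le, h2⟩

end TwoBranches

/-! ### The circle about a boundary point of a polygon -/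

namespace ParamPolygon

variable {P : ParamPolygon} {r : ℝ}

/-- The plane with origin `γ s` and with `I * Γ⁺` as first basis vector: the boundary ahead of
`γ s` is then in the lower half plane, the boundary behind it in the upper one. -/
theorem Crossing.twoBranches {s p m : ℝ} (hc : P.Crossing r s p m) (hP : P.TangentConeGraphLike r)
    (hr : 0 < r) :
    TwoBranches ((fun z => P.γ s + Complex.I * P.dirR s * z) ⁻¹' P.carrier) r
      (Ioc s p) (Ico m (s + P.L)) (fun t => (P.γ t - P.γ s) / (Complex.I * P.dirR s)) := by
  have hcont := P.continuous_γ
  have he : ‖Complex.I * P.dirR s‖ = 1 := by rw [norm_mul, Complex.norm_I, P.norm_dirR, one_mul]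
  have he0 : Complex.I * P.dirR s ≠ 0 := norm_ne_zero_iff.1 (by rw [he]; exact one_ne_zero)
  have hn : ∀ t, ‖(P.γ t - P.γ s) / (Complex.I * P.dirR s)‖ = ‖P.γ t - P.γ s‖ := fun t => by
    rw [norm_div, he, div_one]
  have him : ∀ t, ((P.γ t - P.γ s) / (Complex.I * P.dirR s)).im =
      -inner ℝ ((0 : ℝ) • P.dirL s + (1 : ℝ) • P.dirR s) (P.γ t - P.γ s) := fun t => by
    have h1 : Complex.normSq (Complex.I * P.dirR s) = 1 := by
      rw [Complex.normSq_eq_norm_sq, he, one_pow]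
    rw [zero_smul, one_smul, zero_add, Complex.inner, Complex.div_im, h1]
    simp
    ring
  have hfr : frontier ((fun z => P.γ s + Complex.I * P.dirR s * z) ⁻¹' P.carrier) =
      (fun z => P.γ s + Complex.I * P.dirR s * z) ⁻¹' frontier P.carrier :=
    (((Homeomorph.mulLeft₀ _ he0).trans (Homeomorph.addLeft (P.γ s))).preimage_frontier _).symm
  have hback : ∀ t, P.γ s + Complex.I * P.dirR s *
      ((P.γ t - P.γ s) / (Complex.I * P.dirR s)) = P.γ t := fun t => by
    rw [mul_div_cancel₀ _ he0]; ring
  have hmem : ∀ t, (P.γ t - P.γ s) / (Complex.I * P.dirR s) ∈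
      frontier ((fun z => P.γ s + Complex.I * P.dirR s * z) ⁻¹' P.carrier) := fun t => by
    rw [hfr, mem_preimage, hback]
    exact P.γ_mem_frontier t
  refine ⟨P.isCompact.isClosed.preimage (by fun_prop), ?_, isPreconnected_Ioc, isPreconnected_Ico,
    by fun_prop, ?_, ?_, ?_, ?_, ?_, ?_, ?_, ?_, fun t _ => hmem t, fun t _ => hmem t, ?_⟩
  · simpa using hmem s
  · intro t ht
    rw [him, neg_lt_zero]
    exact hc.inner_pos hP hr le_rfl zero_le_one (by norm_num) ht
  · intro t ht
    rw [him, neg_pos]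
    exact hc.inner_neg hP hr le_rfl zero_le_one (by norm_num) ht
  · simp only [hn]
    exact hc.mono.injOn.mono Ioc_subset_Icc_self
  · simp only [hn]
    exact hc.anti.injOn.mono Ico_subset_Icc_self
  · intro ρ hρ
    simp only [hn]
    obtain ⟨t, ht, e⟩ := intermediate_value_Icc hc.lt_p.le
      (f := fun t => ‖P.γ t - P.γ s‖) (by fun_prop)
      (show ρ ∈ Icc _ _ by simp only [sub_self, norm_zero, hc.norm_p]; exact ⟨hρ.1.le, hρ.2⟩)
    refine ⟨t, ⟨lt_of_le_of_ne ht.1 ?_, ht.2⟩, e⟩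
    rintro rfl
    simp at e
    linarith [hρ.1]
  · intro ρ hρ
    simp only [hn]
    obtain ⟨t, ht, e⟩ := intermediate_value_Icc' hc.m_lt.le
      (f := fun t => ‖P.γ t - P.γ s‖) (by fun_prop)
      (show ρ ∈ Icc _ _ by
        simp only [P.periodic s, sub_self, norm_zero, hc.norm_m]; exact ⟨hρ.1.le, hρ.2⟩)
    refine ⟨t, ⟨ht.1, lt_of_le_of_ne ht.2 ?_⟩, e⟩
    rintro rfl
    simp [P.periodic s] at e
    linarith [hρ.1]
  · intro t ht
    rw [hn, ← hc.norm_p]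
    exact hc.mono.monotoneOn ⟨ht.1.le, ht.2⟩ ⟨hc.lt_p.le, le_rfl⟩ ht.2
  · intro t ht
    rw [hn, ← hc.norm_m]
    exact hc.anti.antitoneOn ⟨le_rfl, hc.m_lt.le⟩ ⟨ht.1, ht.2.le⟩ ht.1
  · intro z hz hz0 hzr
    rw [hfr] at hz
    obtain ⟨t, ht, e⟩ := P.exists_γ_eq_of_mem_frontier s hz
    have hze : (P.γ t - P.γ s) / (Complex.I * P.dirR s) = z := by
      rw [e, add_sub_cancel_left, mul_div_cancel_left₀ _ he0]
    have hst : s < t := lt_of_le_of_ne ht.1 (by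
      rintro rfl
      rw [sub_self, zero_div] at hze
      exact hz0 hze.symm)
    rcases hc.mem_or t ⟨hst, ht.2⟩ (by rwa [← hn, hze]) with h | h
    · exact Or.inl ⟨t, h, hze⟩
    · exact Or.inr ⟨t, h, hze⟩

/-- Just to the left of the first side that leaves `γ s` there are points of the polygon. -/
theorem exists_seed (s : ℝ) {δ : ℝ} (hδ : 0 < δ) :
    ∃ z : ℂ, ‖z‖ < δ ∧ 0 < z.re ∧ z.im < 0 ∧ P.γ s + Complex.I * P.dirR s * z ∈ P.carrier := by
  obtain ⟨i, hi⟩ := P.exists_mem_Ico s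
  have hm : 0 < min (δ / 2) ((P.t (i + 1) - s) / 2) :=
    lt_min (half_pos hδ) (half_pos (sub_pos.2 hi.2))
  set h := min (δ / 2) ((P.t (i + 1) - s) / 2) with hh
  have h1 : h ≤ δ / 2 := min_le_left _ _
  have h2 : h ≤ (P.t (i + 1) - s) / 2 := min_le_right _ _
  have hmem : s + h ∈ Ioo (P.t i) (P.t (i + 1)) := ⟨by linarith [hi.1], by linarith [hi.2]⟩
  have hev := P.interior_left _ _ (P.hasDerivAt_γ hmem)
  obtain ⟨ε, hε, hε'⟩ := (hev.and (Ioo_mem_nhdsGT (half_pos hδ))).exists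
  refine ⟨ε - h * Complex.I, ?_, by simpa using hε'.1, by simpa using hm, ?_⟩
  · refine (norm_sub_le _ _).trans_lt ?_
    rw [norm_mul, Complex.norm_I, Complex.norm_real, Complex.norm_real, Real.norm_of_nonneg hm.le,
      Real.norm_of_nonneg hε'.1.le]
    linarith [hε'.2]
  · have hγ : P.γ (s + h) = P.γ s + h • P.dir i := by
      rw [P.γ_add ⟨hi.1, hi.2.le⟩ ⟨hmem.1.le, hmem.2.le⟩, add_sub_cancel_left]
    have : P.γ s + Complex.I * P.dirR s * (ε - h * Complex.I) =
        P.γ (s + h) + ε • (Complex.I * P.dir i) := by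
      rw [hγ, P.dirR_eq hi, Complex.real_smul, Complex.real_smul]
      linear_combination -(h : ℂ) * P.dir i * Complex.I_sq
    rw [this]
    exact interior_subset hε

/-- The circle of radius `r` about `γ s` meets the polygon exactly in the arc that runs
counterclockwise from the exit point `γ p` to the entry point `γ m`. -/
theorem TangentConeGraphLike.exists_arc (hP : P.TangentConeGraphLike r) (hr : 0 < r) (s : ℝ) :
    ∃ a ∈ Ioo (-Real.pi) 0, ∃ b ∈ Ioo 0 Real.pi,
      (∀ θ ∈ Ioo (-Real.pi) Real.pi,
        polarPoint (P.γ s) (Complex.I * P.dirR s) r θ ∈ P.carrier ↔ θ ∈ Icc a b) ∧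
      (∀ θ ∈ Ioo (-Real.pi) Real.pi,
        polarPoint (P.γ s) (Complex.I * P.dirR s) r θ ∈ frontier P.carrier → θ = a ∨ θ = b) ∧
      ∀ α β : ℝ, 0 ≤ α → 0 ≤ β → 0 < α + β → 0 < inner ℝ (α • P.dirL s + β • P.dirR s)
        (polarPoint (P.γ s) (Complex.I * P.dirR s) r a -
          polarPoint (P.γ s) (Complex.I * P.dirR s) r b) := by
  obtain ⟨p, m, hc⟩ := hP.exists_crossing hr s
  have h2 := hc.twoBranches hP hr
  set e := Complex.I * P.dirR s with he
  have he1 : ‖e‖ = 1 := by rw [he, norm_mul, Complex.norm_I, P.norm_dirR, one_mul]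
  have he0 : e ≠ 0 := norm_ne_zero_iff.1 (by rw [he1]; exact one_ne_zero)
  set κ : ℝ → ℂ := fun t => (P.γ t - P.γ s) / e with hκ
  have hn : ∀ t, ‖κ t‖ = ‖P.γ t - P.γ s‖ := fun t => by
    rw [hκ]; simp only; rw [norm_div, he1, div_one]
  have hp : p ∈ Ioc s p := ⟨hc.lt_p, le_rfl⟩
  have hm : m ∈ Ico m (s + P.L) := ⟨le_rfl, hc.m_lt⟩
  have hpr : ‖κ p‖ = r := by rw [hn, hc.norm_p]
  have hmr : ‖κ m‖ = r := by rw [hn, hc.norm_m]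
  have hpt : ∀ t, ‖κ t‖ = r → polarPoint (P.γ s) e r (κ t).arg = P.γ t := fun t ht => by
    rw [polarPoint, ← ht, Complex.norm_mul_exp_arg_mul_I, hκ]
    simp only
    rw [mul_div_cancel₀ _ he0]; ring
  refine ⟨(κ p).arg, h2.arg_mem₁ hp, (κ m).arg, h2.arg_mem₂ hm, ?_, ?_, ?_⟩
  · obtain ⟨δ, hδ, hR⟩ := P.exists_γ_add_right s
    obtain ⟨z, hzδ, hzre, hzim, hz⟩ := P.exists_seed s (lt_min hδ (sub_pos.2 hc.lt_p))
    have hz0 : 0 < ‖z‖ := norm_pos_iff.2 (by rintro rfl; simp at hzre)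
    have hκz : κ (s + ‖z‖) = -(‖z‖ * Complex.I) := by
      have hI := Complex.I_sq
      rw [hκ]
      simp only
      rw [hR _ ⟨hz0.le, (hzδ.trans_le (min_le_left _ _)).le⟩, add_sub_cancel_left, div_eq_iff he0,
        he, Complex.real_smul]
      linear_combination (‖z‖ : ℂ) * P.dirR s * hI
    have harg : (κ (s + ‖z‖)).arg = -(Real.pi / 2) := by
      rw [hκz, ← mul_neg, Complex.arg_real_mul _ hz0, Complex.arg_neg_I]
    have hnorm : ‖κ (s + ‖z‖)‖ = ‖z‖ := by simp [hκz]
    intro θ hθ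
    refine h2.mem_iff hr (t₀ := s + ‖z‖) (θ₀ := z.arg)
      ⟨by linarith, by linarith [hzδ.trans_le (min_le_right _ _)]⟩ ?_ ?_ hp hpr hm hmr hθ
    · rw [harg]
      exact ⟨(abs_lt.1 (Complex.abs_arg_lt_pi_div_two_iff.2 (Or.inl hzre))).1,
        (Complex.arg_neg_iff.2 hzim).le⟩
    · rw [hnorm, Complex.norm_mul_exp_arg_mul_I]
      exact hz
  · intro θ hθ hfr
    obtain ⟨t, ht, e'⟩ := P.exists_γ_eq_of_mem_frontier s hfr
    have hκt : κ t = r * Complex.exp (θ * Complex.I) := by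
      rw [hκ]
      simp only
      rw [e', polarPoint, add_sub_cancel_left, mul_div_cancel_left₀ _ he0]
    have hκr : ‖κ t‖ = r := by rw [hκt, norm_mul_exp hr.le]
    have harg : (κ t).arg = θ := by rw [hκt, arg_mul_exp hr ⟨hθ.1, hθ.2.le⟩]
    have hst : s < t := lt_of_le_of_ne ht.1 (by
      rintro rfl
      simp [hκ] at hκr
      linarith)
    rcases hc.mem_or t ⟨hst, ht.2⟩ (by rw [← hn, hκr]) with h | h
    · left
      rw [← harg, h2.injOn₁ h hp (hκr.trans hpr.symm)]
    · right
      rw [← harg, h2.injOn₂ h hm (hκr.trans hmr.symm)]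
  · intro α β hα hβ hαβ
    rw [hpt p hpr, hpt m hmr]
    have h3 := hc.inner_pos hP hr hα hβ hαβ hp
    have h4 := hc.inner_neg hP hr hα hβ hαβ hm
    rw [← sub_sub_sub_cancel_right _ _ (P.γ s), inner_sub_right]
    linarith

end ParamPolygon

/-! ### The derivatives of the area invariant determine the turning angles -/

/-- A unit vector `v` making an acute angle with `χ` is determined, relative to `χ`, by `‖χ‖` and
its product with the rotation of `χ`. -/
theorem mul_conj_eq_of_inner_eq {v w χ ψ : ℂ} (hv : ‖v‖ = 1) (hw : ‖w‖ = 1) (hn : ‖χ‖ ^ 2 = ‖ψ‖ ^ 2)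
    (hI : inner ℝ v (Complex.I * χ) = inner ℝ w (Complex.I * ψ))
    (hvχ : 0 < inner ℝ v χ) (hwψ : 0 < inner ℝ w ψ) :
    v * starRingEnd ℂ χ = w * starRingEnd ℂ ψ := by
  have hsq : ∀ x y : ℂ, inner ℝ x y ^ 2 + inner ℝ x (Complex.I * y) ^ 2 = ‖x‖ ^ 2 * ‖y‖ ^ 2 := by
    intro x y
    simp only [← Complex.normSq_eq_norm_sq, Complex.normSq_apply, Complex.inner]
    simp
    ring
  have h1 : inner ℝ v χ = inner ℝ w ψ := by
    refine (pow_left_inj₀ hvχ.le hwψ.le two_ne_zero).1 ?_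
    have e1 := hsq v χ
    have e2 := hsq w ψ
    rw [hv, hn] at e1
    rw [hw] at e2
    rw [hI] at e1
    linarith
  simp only [Complex.inner] at h1 hI
  simp at h1 hI
  apply Complex.ext
  · simp; linarith
  · simp; linarith

theorem setIntegral_arc {a b r : ℝ} (hab : a ≤ b) (ha : -Real.pi < a) (hb : b < Real.pi)
    {K : Set ℂ} {z : ℝ → ℂ} (hK : ∀ θ ∈ Ioo (-Real.pi) Real.pi, z θ ∈ K ↔ θ ∈ Icc a b) (f : ℝ → ℝ) :
    ∫ α in Ioo (-Real.pi) Real.pi, r * K.indicator 1 (z α) * f α = ∫ α in a..b, r * f α := by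
  have hsub : Icc a b ⊆ Ioo (-Real.pi) Real.pi := fun x hx =>
    ⟨ha.trans_le hx.1, hx.2.trans_lt hb⟩
  rw [intervalIntegral.integral_of_le hab, ← integral_Icc_eq_integral_Ioc,
    ← inter_eq_right.2 hsub, ← setIntegral_indicator measurableSet_Icc]
  refine setIntegral_congr_fun measurableSet_Ioo fun θ hθ => ?_
  by_cases h : θ ∈ Icc a b
  · simp [h, (hK θ hθ).2 h]
  · have h' : z θ ∉ K := fun h' => h ((hK θ hθ).1 h')
    simp only [indicator_of_notMem h, indicator_of_notMem h', mul_zero, zero_mul]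

theorem integral_inner_exp (v e : ℂ) (r a b : ℝ) :
    ∫ α in a..b, r * inner ℝ v (e * Complex.exp (α * Complex.I)) =
      inner ℝ v (Complex.I * (polarPoint 0 e r a - polarPoint 0 e r b)) := by
  have hd : ∀ α : ℝ, HasDerivAt
      (fun α : ℝ => r * inner ℝ v (-(Complex.I * (e * Complex.exp (α * Complex.I)))))
      (r * inner ℝ v (e * Complex.exp (α * Complex.I))) α := by
    intro α
    have h1 : HasDerivAt (fun α : ℝ => Complex.exp (α * Complex.I))
        (Complex.exp (α * Complex.I) * Complex.I) α := by
      have := ((Complex.ofRealCLM.hasDerivAt (x := α)).mul_const Complex.I).cexp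
      simpa using this
    have h2 := ((h1.const_mul e).const_mul Complex.I).neg
    have h3 := ((hasDerivAt_const α v).inner ℝ h2).const_mul r
    have h4 : -(Complex.I * (e * (Complex.exp (α * Complex.I) * Complex.I))) =
        e * Complex.exp (α * Complex.I) := by
      linear_combination -(e * Complex.exp (α * Complex.I)) * Complex.I_sq
    rw [inner_zero_left, add_zero, h4] at h3
    exact h3
  rw [intervalIntegral.integral_eq_sub_of_hasDerivAt (fun α _ => hd α)
    (Continuous.intervalIntegrable (by fun_prop) _ _), ← real_inner_smul_right,
    ← real_inner_smul_right, ← inner_sub_right]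
  congr 1
  simp only [polarPoint, Complex.real_smul]
  ring

theorem norm_polarPoint_sub_sq {e : ℂ} (he : ‖e‖ = 1) (c : ℂ) (r a b : ℝ) :
    ‖polarPoint c e r a - polarPoint c e r b‖ ^ 2 = r ^ 2 * (2 - 2 * Real.cos (b - a)) := by
  have : polarPoint c e r a - polarPoint c e r b =
      e * (r * (Complex.exp (a * Complex.I) - Complex.exp (b * Complex.I))) := by
    simp only [polarPoint]; ring
  rw [this, norm_mul, he, one_mul, norm_mul, mul_pow, Complex.norm_real, Real.norm_eq_abs, sq_abs,
    ← Complex.normSq_eq_norm_sq, Complex.normSq_apply, Real.cos_sub]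
  simp only [Complex.sub_re, Complex.sub_im, Complex.exp_ofReal_mul_I_re,
    Complex.exp_ofReal_mul_I_im]
  have h1 := Real.sin_sq_add_cos_sq a
  have h2 := Real.sin_sq_add_cos_sq b
  linear_combination r ^ 2 * h1 + r ^ 2 * h2

namespace ParamPolygon

variable {P : ParamPolygon} {r : ℝ}

/-- At every boundary point the area invariant has a derivative in the radius, which is the length
`r * φ` of the arc of the circle inside the polygon, and one-sided derivatives in the arc length,
which are the products of the one-sided tangents with the rotated chord `χ` of that arc. -/
theorem TangentConeGraphLike.exists_chord (hP : P.TangentConeGraphLike r) (hr : 0 < r) (s : ℝ) :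
    ∃ (φ : ℝ) (χ : ℂ), ‖χ‖ ^ 2 = r ^ 2 * (2 - 2 * Real.cos φ) ∧
      HasDerivAt (fun ρ => P.g s ρ) (r * φ) r ∧
      HasDerivWithinAt (fun σ => P.g σ r) (inner ℝ (P.dirL s) (Complex.I * χ)) (Iio s) s ∧
      HasDerivWithinAt (fun σ => P.g σ r) (inner ℝ (P.dirR s) (Complex.I * χ)) (Ioi s) s ∧
      0 < inner ℝ (P.dirL s) χ ∧ 0 < inner ℝ (P.dirR s) χ := by
  obtain ⟨a, ha, b, hb, hK, hfr, hpos⟩ := hP.exists_arc hr s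
  set e := Complex.I * P.dirR s with he
  have he1 : ‖e‖ = 1 := by rw [he, norm_mul, Complex.norm_I, P.norm_dirR, one_mul]
  have hae : ∀ᵐ α ∂volume.restrict (Ioo (-Real.pi) Real.pi),
      polarPoint (P.γ s) e r α ∉ frontier P.carrier := by
    filter_upwards [ae_restrict_mem measurableSet_Ioo,
      ae_restrict_of_ae ((measure_eq_zero_iff_ae_notMem (μ := volume)).1
        ((toFinite {a, b}).measure_zero volume))]
      with α hα hα'
    exact fun h => hα' (hfr α hα h)
  have hchord : polarPoint (P.γ s) e r a - polarPoint (P.γ s) e r b =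
      polarPoint 0 e r a - polarPoint 0 e r b := by
    simp only [polarPoint]; ring
  have hab : a ≤ b := ha.2.le.trans hb.1.le
  have hcenter : ∀ v : ℂ, ‖v‖ = 1 →
      HasDerivAt (fun h : ℝ => (volume (P.carrier ∩ Metric.closedBall (P.γ s + h • v) r)).toReal)
        (inner ℝ v (Complex.I * (polarPoint (P.γ s) e r a - polarPoint (P.γ s) e r b))) 0 := by
    intro v hv
    have h1 := hasDerivAt_area_center P.isCompact (P.γ s) he1 hv hr hae
    rwa [setIntegral_arc hab ha.1 hb.2 hK, integral_inner_exp, ← hchord] at h1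
  refine ⟨b - a, polarPoint (P.γ s) e r a - polarPoint (P.γ s) e r b,
    norm_polarPoint_sub_sq he1 _ _ _ _, ?_, ?_, ?_, ?_, ?_⟩
  · have h1 := hasDerivAt_area_radius P.isCompact (P.γ s) he1 hr hae
    have h2 := setIntegral_arc (r := r) hab ha.1 hb.2 hK (fun _ => 1)
    simp only [mul_one, intervalIntegral.integral_const, smul_eq_mul] at h2
    rw [h2, mul_comm] at h1
    exact h1
  · obtain ⟨δ, hδ, hL⟩ := P.exists_γ_sub_left s
    have h1 := (HasDerivAt.comp_of_eq s (hcenter _ (P.norm_dirL s))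
      ((hasDerivAt_id s).sub_const s) (by simp)).hasDerivWithinAt (s := Iio s)
    rw [mul_one] at h1
    refine h1.congr_of_eventuallyEq ?_ ?_
    · filter_upwards [Ioo_mem_nhdsLT (sub_lt_self s hδ)] with σ hσ
      have h2 := hL (s - σ) ⟨by linarith [hσ.2], by linarith [hσ.1]⟩
      rw [sub_sub_cancel, sub_eq_add_neg (P.γ s), ← neg_smul, neg_sub] at h2
      rw [g, h2]; rfl
    · simp [g]
  · obtain ⟨δ, hδ, hR⟩ := P.exists_γ_add_right s
    have h1 := (HasDerivAt.comp_of_eq s (hcenter _ (P.norm_dirR s))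
      ((hasDerivAt_id s).sub_const s) (by simp)).hasDerivWithinAt (s := Ioi s)
    rw [mul_one] at h1
    refine h1.congr_of_eventuallyEq ?_ ?_
    · filter_upwards [Ioo_mem_nhdsGT (lt_add_of_pos_right s hδ)] with σ hσ
      have h2 := hR (σ - s) ⟨by linarith [hσ.1], by linarith [hσ.2]⟩
      rw [add_sub_cancel] at h2
      rw [g, h2]; rfl
    · simp [g]
  · simpa using hpos 1 0 zero_le_one le_rfl (by norm_num)
  · simpa using hpos 0 1 le_rfl zero_le_one (by norm_num)

/-- The data at the parameter `s` determine the rotation that takes `Γ⁻` to `Γ⁺`. -/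
theorem dirR_mul_dirL_eq {Q : ParamPolygon} (hr : 0 < r) (hP : P.TangentConeGraphLike r)
    (hQ : Q.TangentConeGraphLike r) {s : ℝ}
    (hg_r : ∀ d : ℝ, HasDerivAt (fun ρ => P.g s ρ) d r ↔ HasDerivAt (fun ρ => Q.g s ρ) d r)
    (hg_s_left : ∀ d : ℝ, HasDerivWithinAt (fun σ => P.g σ r) d (Iio s) s ↔
      HasDerivWithinAt (fun σ => Q.g σ r) d (Iio s) s)
    (hg_s_right : ∀ d : ℝ, HasDerivWithinAt (fun σ => P.g σ r) d (Ioi s) s ↔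
      HasDerivWithinAt (fun σ => Q.g σ r) d (Ioi s) s) :
    P.dirR s * Q.dirL s = Q.dirR s * P.dirL s := by
  obtain ⟨φ, χ, hχ, h1, h2, h3, h4, h5⟩ := hP.exists_chord hr s
  obtain ⟨φ', χ', hχ', h1', h2', h3', h4', h5'⟩ := hQ.exists_chord hr s
  obtain rfl : φ = φ' := mul_left_cancel₀ hr.ne' (((hg_r _).1 h1).unique h1')
  have hn : ‖χ‖ ^ 2 = ‖χ'‖ ^ 2 := hχ.trans hχ'.symm
  have eL := mul_conj_eq_of_inner_eq (P.norm_dirL s) (Q.norm_dirL s) hn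
    ((uniqueDiffWithinAt_Iio s).eq_deriv _ ((hg_s_left _).1 h2) h2') h4 h4'
  have eR := mul_conj_eq_of_inner_eq (P.norm_dirR s) (Q.norm_dirR s) hn
    ((uniqueDiffWithinAt_Ioi s).eq_deriv _ ((hg_s_right _).1 h3) h3') h5 h5'
  have hne : starRingEnd ℂ χ ≠ 0 := by
    rw [Ne, map_eq_zero]
    rintro rfl
    simp at h4
  have hne' : starRingEnd ℂ χ' ≠ 0 := by
    rw [Ne, map_eq_zero]
    rintro rfl
    simp at h4'
  refine mul_right_cancel₀ (mul_ne_zero hne hne') ?_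
  linear_combination (Q.dirL s * starRingEnd ℂ χ') * eR - (Q.dirR s * starRingEnd ℂ χ') * eL

end ParamPolygon

/-! ### Compact sets with a common frontier -/

/-- Two compact sets with the same frontier that agree near all but countably many frontier points
are equal: otherwise the difference would be bounded, and open and closed off a countable set. -/
theorem IsCompact.subset_of_frontier_eq {K₁ K₂ V : Set ℂ} (h₁ : IsCompact K₁) (h₂ : IsCompact K₂)
    (hfr : frontier K₁ = frontier K₂) (hV : V.Countable) (hVf : V ⊆ frontier K₁)
    (hloc : ∀ x ∈ frontier K₁, x ∉ V → ∀ᶠ y in 𝓝 x, y ∈ K₁ ↔ y ∈ K₂) : K₁ ⊆ K₂ := by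
  have hint : interior K₁ ⊆ K₂ := by
    by_contra hcon
    obtain ⟨x, hx1, hx2⟩ := not_subset.1 hcon
    have hpre : IsPreconnected Vᶜ := (hV.isConnected_compl_of_one_lt_rank (by simp)).2
    have hsub : Vᶜ ⊆ interior (interior K₁ ∩ K₂ᶜ) := by
      refine hpre.subset_interior_of_frontier (fun z hzV hz => ?_)
        ⟨x, fun hxV => (hVf hxV).2 hx1, hx1, hx2⟩
      have hz1 : z ∈ K₁ := h₁.isClosed.closure_subset_iff.2
        (inter_subset_left.trans interior_subset) hz.1
      have hz2 : z ∉ interior K₂ := by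
        rw [← mem_compl_iff, ← closure_compl]
        exact closure_mono inter_subset_right hz.1
      by_cases hzf : z ∈ frontier K₁
      · obtain ⟨y, hy, hy'⟩ := (mem_closure_iff_frequently.1 hz.1).and_eventually
          (hloc z hzf hzV) |>.exists
        exact hy.2 (hy'.1 (interior_subset hy.1))
      · have hzi : z ∈ interior K₁ := by
          by_contra h
          exact hzf ⟨subset_closure hz1, h⟩
        refine hz.2 (mem_interior_iff_mem_nhds.2 ?_)
        refine (isOpen_interior.inter h₂.isClosed.isOpen_compl).mem_nhds ⟨hzi, fun hz3 => hzf ?_⟩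
        rw [hfr]
        exact ⟨subset_closure hz3, hz2⟩
    have huniv : K₁ = univ := by
      refine eq_univ_of_forall fun z => ?_
      by_cases hz : z ∈ V
      · exact h₁.isClosed.frontier_subset (hVf hz)
      · exact interior_subset (interior_subset (hsub hz)).1
    exact noncompact_univ ℂ (huniv ▸ h₁)
  intro x hx
  by_cases hi : x ∈ interior K₁
  · exact hint hi
  · refine h₂.isClosed.frontier_subset ?_
    rw [← hfr]
    exact ⟨subset_closure hx, hi⟩

/-! ### Rigidity of the boundary curve -/

theorem StrictMono.eq_of_range_eq_of_zero {f g : ℤ → ℝ} (hf : StrictMono f) (hg : StrictMono g)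
    (h : range f = range g) (h0 : f 0 = g 0) (i : ℤ) : f i = g i := by
  have succ_le : ∀ {f g : ℤ → ℝ}, StrictMono f → StrictMono g → range f = range g → ∀ i,
      f i = g i → g (i + 1) ≤ f (i + 1) := by
    intro f g hf hg h i hi
    obtain ⟨j, hj⟩ : f (i + 1) ∈ range g := h ▸ mem_range_self _
    have h1 : i < j := hg.lt_iff_lt.1 (by rw [hj, ← hi]; exact hf (by lia))
    rw [← hj]
    exact hg.monotone (by lia)
  have pred_le : ∀ {f g : ℤ → ℝ}, StrictMono f → StrictMono g → range f = range g → ∀ i,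
      f i = g i → f (i - 1) ≤ g (i - 1) := by
    intro f g hf hg h i hi
    obtain ⟨j, hj⟩ : f (i - 1) ∈ range g := h ▸ mem_range_self _
    have h1 : j < i := hg.lt_iff_lt.1 (by rw [hj, ← hi]; exact hf (by lia))
    rw [← hj]
    exact hg.monotone (by lia)
  induction i using Int.induction_on with
  | zero => exact h0
  | succ k ih => exact le_antisymm (succ_le hg hf h.symm _ ih.symm) (succ_le hf hg h _ ih)
  | pred k ih => exact le_antisymm (pred_le hf hg h _ ih) (pred_le hg hf h.symm _ ih.symm)

namespace ParamPolygon

variable {P Q : ParamPolygon}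

theorem dir_ne_zero (P : ParamPolygon) (i : ℤ) : P.dir i ≠ 0 :=
  norm_ne_zero_iff.1 (by rw [P.norm_dir]; exact one_ne_zero)

theorem dirL_ne_zero (P : ParamPolygon) (s : ℝ) : P.dirL s ≠ 0 := P.dir_ne_zero _

theorem dirL_t (P : ParamPolygon) (i : ℤ) : P.dirL (P.t i) = P.dir (i - 1) := by
  have := P.dirL_t_succ (i - 1)
  rwa [sub_add_cancel] at this

/-- The vertices are the points where the one-sided tangents differ. -/
theorem mem_range_t_iff (P : ParamPolygon) (s : ℝ) : s ∈ range P.t ↔ P.dirR s ≠ P.dirL s := by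
  constructor
  · rintro ⟨i, rfl⟩ h
    rw [P.dirR_t, P.dirL_t] at h
    have h1 := P.vertex_succ i
    have h2 := P.vertex_succ (i - 1)
    rw [sub_add_cancel, ← h] at h2
    refine P.corner i ?_
    change Collinear ℝ {P.vertex (i - 1), P.vertex i, P.vertex (i + 1)}
    refine (collinear_iff_exists_forall_eq_smul_vadd _).2 ⟨P.vertex i, P.dir i, ?_⟩
    rintro p (rfl | rfl | rfl)
    · exact ⟨-(P.t i - P.t (i - 1)), by rw [vadd_eq_add, neg_smul, h2]; ring⟩
    · exact ⟨0, by simp⟩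
    · exact ⟨P.t (i + 1) - P.t i, by rw [vadd_eq_add, h1]; ring⟩
  · intro h
    obtain ⟨i, hi⟩ := P.exists_mem_Ico s
    by_contra hs
    have hlt : P.t i < s := lt_of_le_of_ne hi.1 fun e => hs ⟨i, e⟩
    exact h ((P.dirR_eq hi).trans (P.dirL_eq ⟨hlt, hi.2.le⟩).symm)

theorem t_zero_le_of_range_eq (h : range P.t = range Q.t) : Q.t 0 ≤ P.t 0 := by
  obtain ⟨j, hj⟩ : P.t 0 ∈ range Q.t := h ▸ mem_range_self _
  rw [← hj]
  refine Q.t_strictMono.monotone ?_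
  by_contra! hlt
  have := Q.t_strictMono.monotone (show j ≤ -1 by lia)
  linarith [Q.t_neg_one, P.t_zero]

theorem t_eq_of_range_eq (h : range P.t = range Q.t) (i : ℤ) : P.t i = Q.t i :=
  P.t_strictMono.eq_of_range_eq_of_zero Q.t_strictMono h
    (le_antisymm (t_zero_le_of_range_eq h.symm) (t_zero_le_of_range_eq h)) i

theorem n_eq_of_t_eq (hL : P.L = Q.L) (ht : ∀ i, P.t i = Q.t i) : P.n = Q.n := by
  have h1 := P.t_add 0
  have h2 := Q.t_add 0
  rw [← ht, ← ht, ← hL, ← h1] at h2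
  have := P.t_strictMono.injective h2
  lia

theorem sideLength_eq (P : ParamPolygon) (i : ℤ) : P.sideLength i = P.t (i + 1) - P.t i :=
  P.unit_speed i

/-- Boundaries with the same vertex parameters whose sides are turned by a common rotation differ by
a rigid motion. -/
theorem exists_γ_eq (ht : ∀ i, P.t i = Q.t i) {a : ℂ} (hdir : ∀ i, Q.dir i = a * P.dir i) (s : ℝ) :
    Q.γ s = a * P.γ s + (Q.vertex 0 - a * P.vertex 0) := by
  have hv : ∀ i, Q.vertex i = a * P.vertex i + (Q.vertex 0 - a * P.vertex 0) := by
    intro i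
    induction i using Int.induction_on with
    | zero => ring
    | succ k ih =>
      rw [Q.vertex_succ, P.vertex_succ, ih, hdir, ht, ht]
      simp only [Complex.real_smul]; ring
    | pred k ih =>
      have h1 := Q.vertex_succ (-(k : ℤ) - 1)
      have h2 := P.vertex_succ (-(k : ℤ) - 1)
      rw [sub_add_cancel] at h1 h2
      rw [h1, hdir, ← ht, ← ht, h2] at ih
      simp only [Complex.real_smul] at ih
      linear_combination ih
  obtain ⟨i, hi⟩ := P.exists_mem_Ico s
  rw [P.γ_eq ⟨hi.1, hi.2.le⟩, Q.γ_eq (i := i) (by rw [← ht, ← ht]; exact ⟨hi.1, hi.2.le⟩), hv i,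
    hdir, ht]
  simp only [Complex.real_smul]; ring

/-! ### The region is determined by its oriented boundary -/

/-- Near an interior point of a side, a closed set bounded by the polygonal curve and lying to its
left is a half plane. -/
theorem eventually_mem_iff_inner_nonneg (P : ParamPolygon) {K : Set ℂ} (hK : IsClosed K)
    (hfr : frontier K = frontier P.carrier) {i : ℤ} {s : ℝ} (hs : s ∈ Ioo (P.t i) (P.t (i + 1)))
    (hleft : ∀ᶠ ε : ℝ in 𝓝[>] 0, P.γ s + ε • (Complex.I * P.dir i) ∈ interior K) :
    ∀ᶠ y in 𝓝 (P.γ s), y ∈ K ↔ 0 ≤ inner ℝ (Complex.I * P.dir i) (y - P.γ s) := by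
  set d := P.dir i with hd
  have hd1 : starRingEnd ℂ d * d = 1 := by
    rw [Complex.conj_mul', P.norm_dir]; norm_num
  obtain ⟨δ, hδ, hδ'⟩ : ∃ δ > 0, Icc (s - δ) (s + δ) ⊆ Icc (P.t i) (P.t (i + 1)) := by
    obtain ⟨ε, hε, h⟩ := Metric.nhds_basis_closedBall.mem_iff.1 (Icc_mem_nhds hs.1 hs.2)
    exact ⟨ε, hε, by rwa [← Real.closedBall_eq_Icc]⟩
  have hγ : ∀ x ∈ Icc (-δ) δ, P.γ (s + x) = P.γ s + x • d := by
    intro x hx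
    rw [P.γ_add (Ioo_subset_Icc_self hs)
      (hδ' (show s + x ∈ _ from ⟨by linarith [hx.1], by linarith [hx.2]⟩)), add_sub_cancel_left]
  -- the rest of the boundary keeps a distance from `γ s`
  have hC : IsCompact (P.γ '' Icc (s + δ) (s + P.L - δ)) := isCompact_Icc.image P.continuous_γ
  have hsC : P.γ s ∉ P.γ '' Icc (s + δ) (s + P.L - δ) := by
    rintro ⟨u, hu, e⟩
    exact P.γ_ne (by linarith [hu.1]) (by linarith [hu.2]) e
  obtain ⟨ρ, hρ, hρC⟩ := Metric.mem_nhds_iff.1 (hC.isClosed.isOpen_compl.mem_nhds hsC)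
  have hinner : ∀ z : ℂ, inner ℝ (Complex.I * d) z = (starRingEnd ℂ d * z).im := by
    intro z
    rw [Complex.inner]
    simp
    ring
  set B := Metric.ball (P.γ s) (min ρ δ) with hB
  have hBpos : 0 < min ρ δ := lt_min hρ hδ
  have honline : ∀ y ∈ B, y ∈ frontier K ↔ inner ℝ (Complex.I * d) (y - P.γ s) = 0 := by
    intro y hy
    rw [hB, Metric.mem_ball, dist_eq_norm] at hy
    rw [hinner]
    constructor
    · intro h
      rw [hfr] at h
      obtain ⟨u, hu, rfl⟩ := P.exists_γ_eq_of_mem_frontier (s - δ) h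
      have hus : u < s + δ := by
        by_contra! hcon
        refine hρC (show P.γ u ∈ Metric.ball _ _ from ?_)
          ⟨u, ⟨hcon, by linarith [hu.2]⟩, rfl⟩
        rw [Metric.mem_ball, dist_eq_norm]
        exact hy.trans_le (min_le_left _ _)
      have := hγ (u - s) ⟨by linarith [hu.1], by linarith⟩
      rw [add_sub_cancel] at this
      rw [this, add_sub_cancel_left, Complex.real_smul, mul_left_comm, hd1, mul_one,
        Complex.ofReal_im]
    · intro h
      set x := (starRingEnd ℂ d * (y - P.γ s)).re with hx
      have hxe : starRingEnd ℂ d * (y - P.γ s) = x := Complex.ext (by simp [hx]) (by simpa using h)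
      have hyx : y = P.γ s + x • d := by
        rw [Complex.real_smul, ← hxe]
        linear_combination -(y - P.γ s) * hd1
      have hxδ : |x| ≤ δ := by
        rw [hyx, add_sub_cancel_left, norm_smul, P.norm_dir, mul_one, Real.norm_eq_abs] at hy
        exact hy.le.trans (min_le_right _ _)
      rw [hyx, ← hγ x (abs_le.1 hxδ), hfr]
      exact P.γ_mem_frontier _
  have hlin : IsLinearMap ℝ fun y : ℂ => inner ℝ (Complex.I * d) y :=
    ⟨fun x y => inner_add_right _ _ _, fun c x => real_inner_smul_right _ _ _⟩
  have hpos : Convex ℝ (B ∩ {y | inner ℝ (Complex.I * d) (P.γ s) < inner ℝ (Complex.I * d) y}) :=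
    (convex_ball _ _).inter (convex_halfSpace_gt hlin _)
  have hneg : Convex ℝ (B ∩ {y | inner ℝ (Complex.I * d) y < inner ℝ (Complex.I * d) (P.γ s)}) :=
    (convex_ball _ _).inter (convex_halfSpace_lt hlin _)
  have hleftK : ∀ y ∈ B, 0 < inner ℝ (Complex.I * d) (y - P.γ s) → y ∈ K := by
    intro y hy hy'
    obtain ⟨ε, hε, hε'⟩ := (hleft.and (Ioo_mem_nhdsGT hBpos)).exists
    have hId : ‖Complex.I * d‖ = 1 := by rw [norm_mul, Complex.norm_I, P.norm_dir, one_mul]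
    refine interior_subset (hpos.isPreconnected.subset_interior_of_frontier (K := K)
      (fun x hx hxf => ?_) ⟨_, ⟨?_, ?_⟩, interior_subset hε⟩ ⟨hy, ?_⟩)
    · have h1 := (honline x hx.1).1 hxf
      rw [inner_sub_right] at h1
      exact hx.2.ne (sub_eq_zero.1 h1).symm
    · rw [hB, Metric.mem_ball, dist_eq_norm, add_sub_cancel_left, norm_smul, hId, mul_one,
        Real.norm_of_nonneg hε'.1.le]
      exact hε'.2
    · change _ < inner ℝ (Complex.I * d) (P.γ s + ε • (Complex.I * d))
      rw [inner_add_right, real_inner_smul_right, real_inner_self_eq_norm_sq, hId]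
      linarith [hε'.1]
    · rw [inner_sub_right] at hy'
      exact sub_pos.1 hy'
  filter_upwards [Metric.ball_mem_nhds (P.γ s) hBpos] with y hy
  constructor
  · intro hyK
    by_contra! hcon
    -- otherwise `K` would contain a whole disk about the frontier point `γ s`
    have hrightK := hneg.isPreconnected.subset_interior_of_frontier (K := K)
      (fun x hx hxf => by
        have h1 := (honline x hx.1).1 hxf
        rw [inner_sub_right] at h1
        exact hx.2.ne (sub_eq_zero.1 h1))
      ⟨y, ⟨hy, by rw [inner_sub_right] at hcon; exact sub_neg.1 hcon⟩, hyK⟩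
    have hsf : P.γ s ∈ frontier K := hfr ▸ P.γ_mem_frontier s
    refine hsf.2 (mem_interior_iff_mem_nhds.2 ?_)
    filter_upwards [Metric.ball_mem_nhds (P.γ s) hBpos] with x hx
    rcases lt_trichotomy (inner ℝ (Complex.I * d) (x - P.γ s)) 0 with h | h | h
    · rw [inner_sub_right] at h
      exact interior_subset (hrightK ⟨hx, sub_neg.1 h⟩)
    · exact hK.frontier_subset ((honline x hx).2 h)
    · exact hleftK x hx h
  · intro h
    rcases h.eq_or_lt with h | h
    · exact hK.frontier_subset ((honline y hy).2 h.symm)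
    · exact hleftK y hy h

theorem carrier_eq_image (hL : P.L = Q.L) (ht : ∀ i, P.t i = Q.t i) {a b : ℂ} (ha : ‖a‖ = 1)
    (hdir : ∀ i, Q.dir i = a * P.dir i) (hγ : ∀ s, Q.γ s = a * P.γ s + b) :
    Q.carrier = (fun z => a * z + b) '' P.carrier := by
  have ha0 : a ≠ 0 := norm_ne_zero_iff.1 (by rw [ha]; exact one_ne_zero)
  set T : ℂ ≃ₜ ℂ := (Homeomorph.mulLeft₀ a ha0).trans (Homeomorph.addRight b) with hT
  change Q.carrier = T '' P.carrier
  have hTa : ∀ z, T z = a * z + b := fun z => rfl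
  have hfr : frontier (T '' P.carrier) = frontier Q.carrier := by
    rw [← T.image_frontier, P.frontier_eq, Q.frontier_eq, image_image, hL]
    exact image_congr fun s _ => (hγ s).symm
  have hcomp : IsCompact (T '' P.carrier) := P.isCompact.image T.continuous
  have hloc : ∀ x ∈ frontier Q.carrier, x ∉ range Q.vertex →
      ∀ᶠ y in 𝓝 x, y ∈ Q.carrier ↔ y ∈ T '' P.carrier := by
    intro x hx hxV
    rw [Q.frontier_eq] at hx
    obtain ⟨s, -, rfl⟩ := hx
    obtain ⟨i, hi⟩ := Q.exists_mem_Ico s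
    have hs : s ∈ Ioo (Q.t i) (Q.t (i + 1)) := by
      refine ⟨lt_of_le_of_ne hi.1 ?_, hi.2⟩
      rintro rfl
      exact hxV ⟨i, rfl⟩
    have hsP : s ∈ Ioo (P.t i) (P.t (i + 1)) := by rwa [ht, ht]
    have h1 := Q.eventually_mem_iff_inner_nonneg Q.isCompact.isClosed rfl hs
      (Q.interior_left _ _ (Q.hasDerivAt_γ hs))
    have h2 := Q.eventually_mem_iff_inner_nonneg hcomp.isClosed hfr hs (by
      filter_upwards [P.interior_left _ _ (P.hasDerivAt_γ hsP)] with ε hε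
      rw [← T.image_interior]
      refine ⟨_, hε, ?_⟩
      rw [hTa, hγ, hdir]
      simp only [Complex.real_smul]; ring)
    filter_upwards [h1, h2] with y hy1 hy2
    rw [hy1, hy2]
  have hV : range Q.vertex ⊆ frontier Q.carrier := by
    rintro _ ⟨i, rfl⟩
    exact Q.γ_mem_frontier _
  refine (Q.isCompact.subset_of_frontier_eq hcomp hfr.symm (countable_range _) hV hloc).antisymm
    (hcomp.subset_of_frontier_eq Q.isCompact hfr (countable_range Q.vertex) (hfr ▸ hV) ?_)
  rw [hfr]
  exact fun x hx hxV => (hloc x hx hxV).mono fun y hy => hy.symm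

end ParamPolygon

theorem mainTheorem1 (P Q : ParamPolygon) (r : ℝ) (hr : 0 < r)
    (hP : P.TangentConeGraphLike r) (hQ : Q.TangentConeGraphLike r)
    -- the data of `P` and `Q` are the same functions, on the same interval `[0, L)`
    (hL : P.L = Q.L)
    (hg : ∀ s ∈ Ico 0 P.L, P.g s r = Q.g s r)
    (hg_r : ∀ s ∈ Ico 0 P.L, ∀ d : ℝ,
      HasDerivAt (fun ρ => P.g s ρ) d r ↔ HasDerivAt (fun ρ => Q.g s ρ) d r)
    (hg_s_left : ∀ s ∈ Ico 0 P.L, ∀ d : ℝ,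
      HasDerivWithinAt (fun σ => P.g σ r) d (Iio s) s ↔
        HasDerivWithinAt (fun σ => Q.g σ r) d (Iio s) s)
    (hg_s_right : ∀ s ∈ Ico 0 P.L, ∀ d : ℝ,
      HasDerivWithinAt (fun σ => P.g σ r) d (Ioi s) s ↔
        HasDerivWithinAt (fun σ => Q.g σ r) d (Ioi s) s) :
    P.n = Q.n ∧ (∀ i, P.t i = Q.t i) ∧
      (∀ i, P.sideLength i = Q.sideLength i) ∧
      (∀ i, P.interiorAngle i = Q.interiorAngle i) ∧
      ∃ a b : ℂ, ‖a‖ = 1 ∧ (∀ s, Q.γ s = a * P.γ s + b) ∧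
        Q.carrier = (fun z => a * z + b) '' P.carrier := by
  -- the data determine the turning at every parameter
  have hturn : ∀ s, P.dirR s * Q.dirL s = Q.dirR s * P.dirL s := by
    intro s
    obtain ⟨s', hs', k, rfl⟩ := P.exists_mem_Ico_add s
    have h := ParamPolygon.dirR_mul_dirL_eq hr hP hQ (hg_r s' hs') (hg_s_left s' hs')
      (hg_s_right s' hs')
    rw [P.dirR_add_mul, P.dirL_add_mul, hL, Q.dirR_add_mul, Q.dirL_add_mul]
    exact h
  have hrange : range P.t = range Q.t := by
    ext s
    rw [P.mem_range_t_iff, Q.mem_range_t_iff, not_iff_not]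
    have h := hturn s
    constructor
    · intro e
      rw [e, mul_comm] at h
      exact (mul_right_cancel₀ (P.dirL_ne_zero s) h).symm
    · intro e
      rw [e, mul_comm (Q.dirL s)] at h
      exact mul_right_cancel₀ (Q.dirL_ne_zero s) h
  have ht : ∀ i, P.t i = Q.t i := ParamPolygon.t_eq_of_range_eq hrange
  have hstep : ∀ i, P.dir i * Q.dir (i - 1) = Q.dir i * P.dir (i - 1) := by
    intro i
    have h := hturn (P.t i)
    rwa [P.dirR_t, P.dirL_t, ht, Q.dirR_t, Q.dirL_t] at h
  set a := Q.dir 0 / P.dir 0 with ha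
  have ha1 : ‖a‖ = 1 := by rw [ha, norm_div, Q.norm_dir, P.norm_dir, div_one]
  have ha0 : a ≠ 0 := norm_ne_zero_iff.1 (by rw [ha1]; exact one_ne_zero)
  have hdir : ∀ i, Q.dir i = a * P.dir i := by
    intro i
    induction i using Int.induction_on with
    | zero => rw [ha, div_mul_cancel₀ _ (P.dir_ne_zero 0)]
    | succ k ih =>
      have h := hstep (k + 1)
      rw [add_sub_cancel_right, ih] at h
      refine mul_right_cancel₀ (P.dir_ne_zero k) ?_
      rw [← h]; ring
    | pred k ih =>
      have h := hstep (-k)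
      rw [ih] at h
      refine mul_left_cancel₀ (P.dir_ne_zero (-k)) ?_
      rw [h]; ring
  have hγ := ParamPolygon.exists_γ_eq ht hdir
  refine ⟨ParamPolygon.n_eq_of_t_eq hL ht, ht, fun i => ?_, fun i => ?_, a, _, ha1, hγ,
    ParamPolygon.carrier_eq_image hL ht ha1 hdir hγ⟩
  · rw [P.sideLength_eq, Q.sideLength_eq, ht, ht]
  · have hv : ∀ i j, Q.vertex i - Q.vertex j = a * (P.vertex i - P.vertex j) := by
      intro i j
      simp only [ParamPolygon.vertex]
      rw [← ht, ← ht, hγ, hγ (P.t j)]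
      ring
    rw [ParamPolygon.interiorAngle, ParamPolygon.interiorAngle, hv, hv, mul_div_mul_left _ _ ha0]
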